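/- **Setting.** Let $(\mathcal S,\mathbb P_{\mathcal S})$ be a probability space of states. For each $s\in\mathcal S$ let $\mathbb A(s)$ be a set of feasible actions, and let $\psi(s,a)\in\mathbb R^d$ be a feature vector for each state $s$ and action $a$. For $\theta\in\mathbb R^d$ put $$\mathcal A_\theta(s)=\operatorname*{arg\,max}_{a\in\mathbb A(s)}\langle\theta,\psi(s,a)\rangle,\qquad \ell^{\rm sub}_\theta(s,a)=\max_{a'\in\mathbb A(s)}\langle\theta,\psi(s,a')-\psi(s,a)\rangle,$$ and assume that $\mathcal A_\theta(s)\neq\emptyset$ for all $\theta\in\mathbb R^d$ and $s\in\mathcal S$. Let $\theta^\star\in\mathbb R^d$, and let the expert choose $a_{\theta^\star}(s)\in\mathcal A_{\theta^\star}(s)$ for every $s$. Let $\Theta\subset\mathbb R^d$ be a convex Borel set containing at most one point of each ray: if $\theta\in\Theta$, then $\alpha\theta\notin\Theta$ for all real $\alpha\ne1$. Assume that $s\mapsto\ell^{\rm sub}_\theta(s,a_{\theta^\star}(s))$ is measurable for every $\theta\in\Theta$. Let $J:\mathbb R^d\to\mathbb R$ be convex. Let $s_1,\dots,s_T$ be i.i.d.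 with law $\mathbb P_{\mathcal S}$, put $a_t^\star=a_{\theta^\star}(s_t)$ and $D_T=\{(s_t,a_t^\star)\}_{t=1}^T$, and consider the scenario program $$\min_{\theta\in\Theta}J(\theta)\quad\text{subject to}\quad \ell^{\rm sub}_\theta(s_t,a^\star_t)\le0\quad(t=1,\dots,T).$$ Assume that with probability $1$ it has a unique optimizer $\hat\theta^{\rm sub}_T$, and that this is a random variable (measurable in the sample up to null sets). For $\varepsilon\in(0,1]$ and $\beta\in(0,1)$ let $$N(\varepsilon,\beta)=\min\Bigl\{n\in\mathbb N:\ \sum_{i=0}^{d-1}\binom ni\varepsilon^i(1-\varepsilon)^{n-i}\le\beta\Bigr\}.$$ **Proposition (Set-level mismatch).** Fix $\beta\in(0,1)$. 1. If $\varepsilon\in(0,1]$ and $T\ge N(\varepsilon,\beta)$, then with probability at least $1-\beta$ over the draw of $D_T$, $$\mathbb P_{\mathcal S}\bigl(a_{\theta^\star}(s)\notin\mathcal A_{\hat\theta^{\rm sub}_T}(s)\bigr)\le\varepsilon .$$ 2. In particular, if $T\ge2\bigl(d+\log(1/\beta)\bigr)$, then $\varepsilon=\frac2T\bigl(d+\log(1/\beta)\bigr)$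 satisfies $T\ge N(\varepsilon,\beta)$, and with probability at least $1-\beta$ over the draw of $D_T$, $$\mathbb P_{\mathcal S}\bigl(a_{\theta^\star}(s)\notin\mathcal A_{\hat\theta^{\rm sub}_T}(s)\bigr)\le\frac2T\bigl(d+\log(1/\beta)\bigr).$$ -/

import Mathlib

open MeasureTheory

namespace InverseOpt

/-- The set `𝒜_θ(s)` of maximizers over the feasible actions `A s` of the linear score
`a ↦ ⟨θ, ψ(s, a)⟩`. -/
def greedySet {S Act : Type*} {d : ℕ} (A : S → Set Act)
    (ψ : S → Act → EuclideanSpace ℝ (Fin d)) (θ : EuclideanSpace ℝ (Fin d)) (s : S) : Set Act :=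
  {a | a ∈ A s ∧ ∀ a' ∈ A s, inner ℝ θ (ψ s a') ≤ inner ℝ θ (ψ s a)}

/-- The suboptimality gap `ℓ_θ(s, a) = max_{a' ∈ A s} ⟨θ, ψ(s, a') - ψ(s, a)⟩`.  The supremum is
attained, hence is this maximum, whenever `greedySet A ψ θ s` is non-empty. -/
noncomputable def subGap {S Act : Type*} {d : ℕ} (A : S → Set Act)
    (ψ : S → Act → EuclideanSpace ℝ (Fin d)) (θ : EuclideanSpace ℝ (Fin d))
    (s : S) (a : Act) : ℝ :=
  sSup ((fun a' => inner ℝ θ (ψ s a' - ψ s a)) '' A s)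

/-- The feasible set of the scenario program with data `D = ((s_t, a_t))_t`: the parameters
`θ ∈ Θ` such that `ℓ_θ(s_t, a_t) ≤ 0` for every `t`. -/
def scenarioFeasible {S Act : Type*} {d T : ℕ} (A : S → Set Act)
    (ψ : S → Act → EuclideanSpace ℝ (Fin d)) (Θ : Set (EuclideanSpace ℝ (Fin d)))
    (D : Fin T → S × Act) : Set (EuclideanSpace ℝ (Fin d)) :=
  {θ | θ ∈ Θ ∧ ∀ t, subGap A ψ θ (D t).1 (D t).2 ≤ 0}

/-- `θ` is the unique minimizer of `J` over the feasible set of the scenario program. -/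
def IsUniqueOptimizer {S Act : Type*} {d T : ℕ} (A : S → Set Act)
    (ψ : S → Act → EuclideanSpace ℝ (Fin d)) (Θ : Set (EuclideanSpace ℝ (Fin d)))
    (J : EuclideanSpace ℝ (Fin d) → ℝ) (D : Fin T → S × Act)
    (θ : EuclideanSpace ℝ (Fin d)) : Prop :=
  (θ ∈ scenarioFeasible A ψ Θ D ∧ IsMinOn J (scenarioFeasible A ψ Θ D) θ) ∧
    ∀ θ' ∈ scenarioFeasible A ψ Θ D, IsMinOn J (scenarioFeasible A ψ Θ D) θ' → θ' = θ

/-- The data set `D_T = ((s_t, a_t))_t` of the expert policy `aStar` on the states `s_t`. -/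
def demonstrations {S Act : Type*} {T : ℕ} (aStar : S → Act) (s : Fin T → S) :
    Fin T → S × Act :=
  fun t => (s t, aStar (s t))

/-- `∑_{i < d} C(n, i) ε^i (1 - ε)^(n - i)`.  (Terms with `i > n` vanish, since `C(n, i) = 0`.) -/
noncomputable def binomialTail (d n : ℕ) (ε : ℝ) : ℝ :=
  ∑ i ∈ Finset.range d, (n.choose i : ℝ) * ε ^ i * (1 - ε) ^ (n - i)

/-- `N(ε, β)`, the least `n` with `binomialTail d n ε ≤ β`.  For `0 < ε ≤ 1` and `0 < β` there is
such an `n`, because the tail tends to `0` as `n` tends to infinity. -/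
noncomputable def sampleSize (d : ℕ) (ε β : ℝ) : ℕ :=
  sInf {n : ℕ | binomialTail d n ε ≤ β}

/-- The set-level mismatch of `θ`: the `P`-probability that `aStar s` is not in `𝒜_θ(s)`. -/
noncomputable def setMismatch {S Act : Type*} [MeasurableSpace S] {d : ℕ} (P : Measure S)
    (A : S → Set Act) (ψ : S → Act → EuclideanSpace ℝ (Fin d)) (aStar : S → Act)
    (θ : EuclideanSpace ℝ (Fin d)) : ℝ :=
  P.real {s | aStar s ∉ greedySet A ψ θ s}

end InverseOpt

namespace InverseOpt

/-! The mismatch probability of the optimizer is the probability that it violates a fresh convex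
constraint, so this is the scenario bound. The tail stops at `d - 1` because `Θ`, meeting each ray
at most once, has affine dimension at most `k = d - 1`.

Add a ghost sample of size `M`, put `n = T + M`, and call a `T`-subset `G` of the `n` constraints
bad if its optimizer violates at least `v` constraints outside `G`. Helly's theorem gives `k`
constraints `B ⊆ G` that already exclude every better point. Let `V` be `v` violated constraints. If
`B ⊆ G' ⊆ G ∪ V` for another bad `G'`, then `G'` has strictly larger optimal value, ties being
broken by the norm. This is a skew set-pair condition, and `card_le_of_skew` bounds such families by
exterior algebra: each `G` yields an alternating `T`-form, the forms are triangular on the moment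
curve, and they all lie in a space whose dimension is the number of `T`-sets with at most `k`
elements among the top `v + k` indices. Counting words instead of sets turns this number into a
binomial tail (`card_mul_factorial_le_of_optimizer`).

Exchangeability converts the count into a probability, Chebyshev's inequality replaces violation
frequencies by probabilities, and `M → ∞` with `v ≈ ε' M`, then `ε' ↑ ε`, gives the exact tail
(`measureReal_lt_le_binomialTail`). The explicit rate is Chernoff's bound. -/

/-! ### Binomial tails and the sample size. -/

theorem binomialTail_mono {d d' : ℕ} (h : d ≤ d') (n : ℕ) {ε : ℝ} (h0 : 0 ≤ ε) (h1 : ε ≤ 1) :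
    binomialTail d n ε ≤ binomialTail d' n ε := by
  unfold binomialTail
  have : 0 ≤ 1 - ε := by linarith
  exact Finset.sum_le_sum_of_subset_of_nonneg (Finset.range_mono h) fun _ _ _ => by positivity

/-- Pascal's rule, or conditioning on one trial; it yields monotonicity in `n`. -/
theorem binomialTail_succ_succ (d n : ℕ) (ε : ℝ) :
    binomialTail (d + 1) (n + 1) ε
      = (1 - ε) * binomialTail (d + 1) n ε + ε * binomialTail d n ε := by
  have hterm : ∀ i, ((n + 1).choose i : ℝ) * ε ^ i * (1 - ε) ^ (n + 1 - i)
      = (1 - ε) * ((n.choose i : ℝ) * ε ^ i * (1 - ε) ^ (n - i))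
        + (if i = 0 then 0 else
          ε * ((n.choose (i - 1) : ℝ) * ε ^ (i - 1) * (1 - ε) ^ (n - (i - 1)))) := by
    intro i
    rcases i with _ | i
    · simp [pow_succ]; ring
    · rw [if_neg (Nat.succ_ne_zero i), Nat.add_sub_cancel, Nat.choose_succ_succ,
        Nat.add_sub_add_right]
      push_cast
      rcases le_or_gt (i + 1) n with h | h
      · obtain ⟨m, rfl⟩ := Nat.exists_eq_add_of_le h
        rw [show i + 1 + m - i = m + 1 by omega, show i + 1 + m - (i + 1) = m by omega]
        ring
      · rw [Nat.choose_eq_zero_of_lt h]; push_cast; ring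
  unfold binomialTail
  rw [Finset.sum_congr rfl fun i _ => hterm i, Finset.sum_add_distrib, ← Finset.mul_sum,
    Finset.sum_range_succ' (fun i => if i = 0 then (0 : ℝ) else _), Finset.mul_sum (Finset.range d)]
  simp

theorem binomialTail_antitone (d : ℕ) {ε : ℝ} (h0 : 0 ≤ ε) (h1 : ε ≤ 1) :
    Antitone fun n => binomialTail d n ε := by
  refine antitone_nat_of_succ_le fun n => ?_
  rcases d with _ | d
  · simp [binomialTail]
  · rw [binomialTail_succ_succ]
    have := mul_le_mul_of_nonneg_left (binomialTail_mono (Nat.le_succ d) n h0 h1) h0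
    nlinarith

theorem binomialTail_eq_one {d n : ℕ} (h : n < d) (ε : ℝ) : binomialTail d n ε = 1 := by
  have h2 : binomialTail (n + 1) n ε = 1 := by
    have := add_pow ε (1 - ε) n
    rw [add_sub_cancel, one_pow] at this
    rw [this, binomialTail]
    exact Finset.sum_congr rfl fun i _ => by ring
  rw [← h2, binomialTail, binomialTail]
  refine (Finset.sum_subset (Finset.range_mono h) fun i _ hi => ?_).symm
  rw [Finset.mem_range, not_lt] at hi
  rw [Nat.choose_eq_zero_of_lt hi]; simp

/-- Chernoff's bound for the lower binomial tail, with parameter `1 / 2`. -/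
theorem binomialTail_le (d n : ℕ) {ε : ℝ} (h0 : 0 ≤ ε) (h1 : ε ≤ 1) :
    binomialTail d n ε ≤ 2 ^ d * (1 - ε / 2) ^ n := by
  have h1' : 0 ≤ 1 - ε := by linarith
  calc binomialTail d n ε
      ≤ ∑ i ∈ Finset.range d,
          2 ^ d * ((ε / 2) ^ i * (1 - ε) ^ (n - i) * (n.choose i : ℝ)) := by
        refine Finset.sum_le_sum fun i hi => ?_
        have : (2 : ℝ) ^ i ≤ 2 ^ d :=
          pow_le_pow_right₀ one_le_two (Finset.mem_range.1 hi).le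
        calc (n.choose i : ℝ) * ε ^ i * (1 - ε) ^ (n - i)
            = 2 ^ i * ((ε / 2) ^ i * (1 - ε) ^ (n - i) * (n.choose i : ℝ)) := by
              rw [div_pow]; field_simp
          _ ≤ _ := by gcongr
    _ ≤ ∑ i ∈ Finset.range (max d (n + 1)),
          2 ^ d * ((ε / 2) ^ i * (1 - ε) ^ (n - i) * (n.choose i : ℝ)) :=
        Finset.sum_le_sum_of_subset_of_nonneg (Finset.range_mono (le_max_left _ _))
          fun _ _ _ => by positivity
    _ = ∑ i ∈ Finset.range (n + 1),
          2 ^ d * ((ε / 2) ^ i * (1 - ε) ^ (n - i) * (n.choose i : ℝ)) := by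
        refine (Finset.sum_subset (Finset.range_mono (le_max_right _ _)) fun i _ hi => ?_).symm
        rw [Finset.mem_range, not_lt] at hi
        rw [Nat.choose_eq_zero_of_lt hi]; simp
    _ = 2 ^ d * (1 - ε / 2) ^ n := by
        rw [← Finset.mul_sum, ← add_pow]; congr 2; ring

theorem binomialTail_le_of_sampleSize_le {d T : ℕ} {ε β : ℝ} (h0 : 0 < ε) (h1 : ε ≤ 1)
    (hβ : 0 < β) (h : sampleSize d ε β ≤ T) : binomialTail d T ε ≤ β := by
  have hne : {n : ℕ | binomialTail d n ε ≤ β}.Nonempty := by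
    have ht : Filter.Tendsto (fun n : ℕ => (2 : ℝ) ^ d * (1 - ε / 2) ^ n) Filter.atTop
        (nhds (2 ^ d * 0)) :=
      (tendsto_pow_atTop_nhds_zero_of_lt_one (by linarith) (by linarith)).const_mul _
    rw [mul_zero] at ht
    obtain ⟨n, hn⟩ := (ht.eventually (gt_mem_nhds hβ)).exists
    exact ⟨n, (binomialTail_le d n h0.le h1).trans hn.le⟩
  exact (binomialTail_antitone d h0.le h1 h).trans (Nat.sInf_mem hne)

/-- Since `1 - x ≤ exp (-x)`, the Chernoff bound is at most `2 ^ d * exp (-T ε / 2) = (2 / e) ^ d *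
β`, and `2 ≤ e`. -/
theorem binomialTail_le_of_eq {d T : ℕ} {ε β : ℝ} (h0 : 0 ≤ ε) (h1 : ε ≤ 1)
    (hβ : 0 < β) (h : T * ε = 2 * (d + Real.log (1 / β))) : binomialTail d T ε ≤ β := by
  have h2 : (1 - ε / 2) ^ T ≤ Real.exp (-(ε / 2)) ^ T :=
    pow_le_pow_left₀ (by linarith) (by linarith [Real.add_one_le_exp (-(ε / 2))]) _
  have h3 : Real.exp (-(ε / 2)) ^ T = Real.exp (-1) ^ d * β := by
    rw [← Real.exp_nat_mul, ← Real.exp_nat_mul, one_div, Real.log_inv] at *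
    rw [show (T : ℝ) * -(ε / 2) = d * -1 + Real.log β by linarith, Real.exp_add, Real.exp_log hβ]
  have h4 : 2 * Real.exp (-1) ≤ 1 := by
    have := Real.add_one_le_exp 1
    rw [Real.exp_neg, ← div_eq_mul_inv, div_le_one (Real.exp_pos 1)]
    linarith
  calc binomialTail d T ε ≤ 2 ^ d * (1 - ε / 2) ^ T := binomialTail_le d T h0 h1
    _ ≤ 2 ^ d * (Real.exp (-1) ^ d * β) := by rw [← h3]; gcongr
    _ = (2 * Real.exp (-1)) ^ d * β := by rw [mul_pow]; ring
    _ ≤ 1 * β := by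
        gcongr
        exact pow_le_one₀ (by positivity) h4
    _ = β := one_mul β

/-! ### Alternating forms on the moment curve and the skew set-pair bound. -/

open Polynomial in
/-- The linear functional on `ℝⁿ` whose coordinates are the coefficients of `p`. -/
noncomputable def coeffForm (n : ℕ) (p : ℝ[X]) : (Fin n → ℝ) →ₗ[ℝ] ℝ :=
  ∑ e : Fin n, p.coeff e • LinearMap.proj e

theorem coeffForm_single {n : ℕ} (p : Polynomial ℝ) (e : Fin n) :
    coeffForm n p (Pi.single e 1) = p.coeff e := by
  simp [coeffForm, Pi.single_apply]

theorem coeffForm_moment {n : ℕ} {p : Polynomial ℝ} (hp : p.natDegree < n) (x : ℝ) :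
    coeffForm n p (fun e => x ^ (e : ℕ)) = p.eval x := by
  simp only [coeffForm, LinearMap.sum_apply, LinearMap.smul_apply, LinearMap.proj_apply,
    smul_eq_mul]
  rw [Polynomial.eval_eq_sum_range' hp, Finset.sum_range]

/-- The points of the moment curve in `ℝⁿ`. -/
noncomputable def momentPoint {n : ℕ} (i : Fin n) : Fin n → ℝ := fun e => (i : ℝ) ^ (e : ℕ)

open Polynomial in
/-- Polynomials attached to `B ⊆ G` and a set `Z` disjoint from `G`. -/
noncomputable def formPoly {n : ℕ} (B Z : Finset (Fin n)) (m : ℕ) : B ⊕ Fin m → ℝ[X] :=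
  Sum.elim (fun b => Lagrange.basis Finset.univ (fun i : Fin n => (i : ℝ)) b)
    (fun a => (∏ j ∈ Z, (X - C (j : ℝ))) * X ^ (a : ℕ))

theorem injective_cast_fin (n : ℕ) : Function.Injective (fun i : Fin n => (i : ℝ)) :=
  fun _ _ h => Fin.ext (Nat.cast_injective h)

theorem natDegree_formPoly_inr {n : ℕ} (B Z : Finset (Fin n)) (m : ℕ) (a : Fin m) :
    (formPoly B Z m (.inr a)).natDegree = Z.card + a := by
  simp only [formPoly, Sum.elim_inr]
  rw [Polynomial.Monic.natDegree_mul (Polynomial.monic_prod_of_monic _ _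
    fun _ _ => Polynomial.monic_X_sub_C _) (Polynomial.monic_X_pow _)]
  rw [Polynomial.natDegree_prod_of_monic _ _ fun _ _ => Polynomial.monic_X_sub_C _]
  simp only [Polynomial.natDegree_X_sub_C, Finset.sum_const, smul_eq_mul, mul_one,
    Polynomial.natDegree_X_pow]

theorem natDegree_formPoly_lt {n : ℕ} (B Z : Finset (Fin n)) (m : ℕ) (h : Z.card + m ≤ n)
    (x : B ⊕ Fin m) : (formPoly B Z m x).natDegree < n := by
  rcases x with b | a
  · have hn : 0 < n := b.1.pos
    simp only [formPoly, Sum.elim_inl]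
    have := Lagrange.degree_basis (s := Finset.univ) (v := fun i : Fin n => (i : ℝ))
      (injective_cast_fin n).injOn (Finset.mem_univ b.1)
    rw [Polynomial.natDegree_eq_of_degree_eq_some this]
    simpa using hn
  · rw [natDegree_formPoly_inr]; omega

theorem eval_formPoly_inl {n : ℕ} (B Z : Finset (Fin n)) (m : ℕ) (b : B) (i : Fin n) :
    (formPoly B Z m (.inl b)).eval (i : ℝ) = if i = b then 1 else 0 := by
  simp only [formPoly, Sum.elim_inl]
  split_ifs with h
  · subst h
    exact Lagrange.eval_basis_self (v := fun i : Fin n => (i : ℝ))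
      (injective_cast_fin n).injOn (Finset.mem_univ _)
  · exact Lagrange.eval_basis_of_ne (v := fun i : Fin n => (i : ℝ)) (Ne.symm h)
      (Finset.mem_univ _)

theorem eval_formPoly_inr {n : ℕ} (B Z : Finset (Fin n)) (m : ℕ) (a : Fin m) (x : ℝ) :
    (formPoly B Z m (.inr a)).eval x = (∏ j ∈ Z, (x - (j : ℝ))) * x ^ (a : ℕ) := by
  simp [formPoly, Polynomial.eval_mul, Polynomial.eval_prod]

/-- An alternating form which vanishes on tuples of coordinate vectors having more than `#B`
high indices, and on moment points detects the interval between `B` and `Zᶜ`. -/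
theorem exists_alternating {n T r : ℕ} {B G Z : Finset (Fin n)} (hG : G.card = T) (hBG : B ⊆ G)
    (hGZ : Disjoint G Z) (hr : Z.card + (T - B.card) ≤ r) (hrn : r ≤ n) :
    ∃ φ : (Fin n → ℝ) [⋀^Fin T]→ₗ[ℝ] ℝ,
      (∀ e : Fin T → Fin n, B.card < (Finset.univ.filter fun j => r ≤ (e j : ℕ)).card →
        φ (fun j => Pi.single (e j) 1) = 0) ∧
      (∀ g : Fin T → Fin n, φ (fun j => momentPoint (g j)) ≠ 0 →
        (∀ b ∈ B, ∃ j, g j = b) ∧ ∀ j, g j ∉ Z) ∧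
      (∀ g : Fin T → Fin n, Function.Injective g → (∀ j, g j ∈ G) →
        φ (fun j => momentPoint (g j)) ≠ 0) := by
  classical
  have hBT : B.card ≤ T := hG ▸ Finset.card_le_card hBG
  set m := T - B.card with hm
  obtain ⟨q⟩ : Nonempty (Fin T ≃ B ⊕ Fin m) :=
    ⟨Fintype.equivOfCardEq (by simp; omega)⟩
  have hdeg := natDegree_formPoly_lt B Z m (hr.trans hrn)
  -- The form is the determinant of `T` coefficient functionals: coordinate vectors read off
  -- coefficients of the polynomials, moment points read off their values.
  let L : (Fin n → ℝ) →ₗ[ℝ] (Fin T → ℝ) :=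
    LinearMap.pi fun a => coeffForm n (formPoly B Z m (q a))
  let φ : (Fin n → ℝ) [⋀^Fin T]→ₗ[ℝ] ℝ := Matrix.detRowAlternating.compLinearMap L
  have hφs : ∀ e : Fin T → Fin n, φ (fun j => Pi.single (e j) 1)
      = Matrix.det (Matrix.of fun j a => (formPoly B Z m (q a)).coeff (e j)) := by
    intro e
    change Matrix.det _ = _
    congr 1
    ext j a
    exact coeffForm_single _ _
  have hφm : ∀ g : Fin T → Fin n, φ (fun j => momentPoint (g j))
      = Matrix.det (Matrix.of fun j a => (formPoly B Z m (q a)).eval (g j : ℝ)) := by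
    intro e
    change Matrix.det _ = _
    congr 1
    ext j a
    exact coeffForm_moment (hdeg _) _
  refine ⟨φ, fun e he => ?_, fun g hg => ⟨fun b hb => ?_, fun j hj => ?_⟩, fun g hgi hgG => ?_⟩
  · rw [hφs, Matrix.det_apply]
    refine Finset.sum_eq_zero fun σ _ => ?_
    -- The columns `inr` have degree below `r`, so their coefficients at high indices are zero. A
    -- nonzero term of the determinant would inject the high indices into the `#B` Lagrange columns.
    suffices h : ∃ a, ∃ x, q a = .inr x ∧ r ≤ (e (σ a) : ℕ) by
      obtain ⟨a, x, hx, hlt⟩ := h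
      rw [Finset.prod_eq_zero (Finset.mem_univ a), smul_zero]
      simp only [Matrix.of_apply, hx]
      refine Polynomial.coeff_eq_zero_of_natDegree_lt ?_
      rw [natDegree_formPoly_inr]
      omega
    by_contra! hcon
    refine he.not_ge ?_
    have hmaps : ∀ j ∈ Finset.univ.filter fun j => r ≤ (e j : ℕ),
        q (σ.symm j) ∈ Finset.univ.map
          (⟨Sum.inl, Sum.inl_injective⟩ : B ↪ B ⊕ Fin m) := by
      intro j hj
      rw [Finset.mem_filter] at hj
      rcases hq : q (σ.symm j) with b | x
      · simp
      · have := hcon _ _ hq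
        rw [Equiv.apply_symm_apply] at this
        omega
    have := Finset.card_le_card_of_injOn (fun j => q (σ.symm j)) hmaps
      (by intro x _ y _ h; simpa using h)
    simpa using this
  · by_contra! hcon
    apply hg
    rw [hφm]
    refine Matrix.det_eq_zero_of_column_eq_zero (q.symm (.inl ⟨b, hb⟩)) fun j => ?_
    simp only [Matrix.of_apply, Equiv.apply_symm_apply, eval_formPoly_inl]
    exact if_neg (hcon j)
  · apply hg
    rw [hφm]
    refine Matrix.det_eq_zero_of_row_eq_zero j fun a => ?_
    simp only [Matrix.of_apply]
    rcases q a with b | x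
    · rw [eval_formPoly_inl, if_neg]
      rintro h
      exact (Finset.disjoint_left.1 hGZ (hBG b.2)) (h ▸ hj)
    · rw [eval_formPoly_inr, Finset.prod_eq_zero hj (sub_self _), zero_mul]
  · rw [hφm]
    intro h0
    -- A kernel vector is a combination of the polynomials vanishing on `G`. On `G \ B` the Lagrange
    -- terms drop out and the product over `Z` is nonzero, so a polynomial of degree below `m = #(G
    -- \ B)` has `m` roots. Its coefficients vanish, and then evaluation on `B` kills the rest.
    obtain ⟨c, hc, hc0⟩ := Matrix.exists_mulVec_eq_zero_iff.2 h0
    apply hc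
    have hsurj : ∀ i ∈ G, ∃ j, g j = i := by
      intro i hi
      have h1 : Finset.univ.image g = G :=
        Finset.eq_of_subset_of_card_le (fun x hx => by
          obtain ⟨j, _, rfl⟩ := Finset.mem_image.1 hx; exact hgG j)
          (by rw [Finset.card_image_of_injective _ hgi, hG]; simp)
      rw [← h1] at hi
      obtain ⟨j, _, h⟩ := Finset.mem_image.1 hi
      exact ⟨j, h⟩
    have hrow : ∀ i ∈ G, ∑ x, (formPoly B Z m x).eval (i : ℝ) * c (q.symm x) = 0 := by
      intro i hi
      obtain ⟨j, rfl⟩ := hsurj i hi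
      have := congrFun hc0 j
      simp only [Matrix.mulVec, dotProduct, Matrix.of_apply, Pi.zero_apply] at this
      rw [← this]
      exact (Fintype.sum_equiv q _ _ fun a => by simp).symm
    simp only [Fintype.sum_sum_type, eval_formPoly_inl, eval_formPoly_inr] at hrow
    have hZ : ∀ i ∈ G, (∏ j ∈ Z, ((i : ℝ) - (j : ℝ))) ≠ 0 := by
      intro i hi
      refine Finset.prod_ne_zero_iff.2 fun j hj h => ?_
      have : i = j := injective_cast_fin n (sub_eq_zero.1 h)
      exact Finset.disjoint_left.1 hGZ hi (this ▸ hj)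
    have hQ : (∑ x : Fin m, Polynomial.C (c (q.symm (.inr x))) * Polynomial.X ^ (x : ℕ)) = 0 := by
      refine Polynomial.eq_zero_of_degree_lt_of_eval_finset_eq_zero
        (s := (G \ B).map ⟨fun i : Fin n => (i : ℝ), injective_cast_fin n⟩) ?_ ?_
      · rw [Finset.card_map, Finset.card_sdiff_of_subset hBG, hG]
        refine (Polynomial.degree_sum_le _ _).trans_lt ?_
        rw [Finset.sup_lt_iff (by exact WithBot.bot_lt_coe _)]
        intro x _
        exact (Polynomial.degree_C_mul_X_pow_le _ _).trans_lt (by exact_mod_cast x.2)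
      · intro y hy
        obtain ⟨i, hi, rfl⟩ := Finset.mem_map.1 hy
        rw [Finset.mem_sdiff] at hi
        have h1 := hrow i hi.1
        rw [Finset.sum_eq_zero fun b _ => by
          rw [if_neg (fun h : i = b => hi.2 (h ▸ b.2)), zero_mul], zero_add] at h1
        simp only [mul_assoc, ← Finset.mul_sum] at h1
        have h2 := (mul_eq_zero.1 h1).resolve_left (hZ i hi.1)
        simp only [Function.Embedding.coeFn_mk, Polynomial.eval_finsetSum, Polynomial.eval_mul,
          Polynomial.eval_C, Polynomial.eval_pow, Polynomial.eval_X]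
        rw [← h2]
        exact Finset.sum_congr rfl fun _ _ => mul_comm _ _
    have hcr : ∀ x : Fin m, c (q.symm (.inr x)) = 0 := by
      intro x
      have := congrArg (fun p => Polynomial.coeff p (x : ℕ)) hQ
      simpa [Polynomial.finsetSum_coeff, Polynomial.coeff_X_pow, Fin.val_inj] using this
    have hcl : ∀ b : B, c (q.symm (.inl b)) = 0 := by
      intro b
      have := hrow b (hBG b.2)
      simpa [hcr, Subtype.coe_inj] using this
    funext a
    rw [← q.symm_apply_apply a]
    rcases q a with b | x
    · exact hcl b
    · exact hcr x

/-- Take the forms of `exists_alternating` with `Z = (G ∪ V G)ᶜ`; then `#Z + (T - k) = n - v - k`,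
which fixes the threshold for high indices. The forms are determined by their values on the counted
sets `R`, and skewness makes them linearly independent. -/
theorem card_le_of_skew {n T k v : ℕ} {α : Type*} [LinearOrder α]
    (F : Finset (Finset (Fin n))) (B V : Finset (Fin n) → Finset (Fin n))
    (w : Finset (Fin n) → α) (hTv : T + v ≤ n) (hkT : k ≤ T)
    (hF : ∀ G ∈ F, G.card = T) (hB : ∀ G ∈ F, B G ⊆ G) (hBc : ∀ G ∈ F, (B G).card = k)
    (hV : ∀ G ∈ F, Disjoint G (V G)) (hVc : ∀ G ∈ F, (V G).card = v)
    (hskew : ∀ G ∈ F, ∀ G' ∈ F, B G ⊆ G' → G' ⊆ G ∪ V G → G' = G ∨ w G < w G') :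
    F.card ≤ ((Finset.univ.powersetCard T).filter fun R : Finset (Fin n) =>
      (R.filter fun e : Fin n => n - v - k ≤ (e : ℕ)).card ≤ k).card := by
  classical
  set r := n - v - k with hr
  have hex : ∀ G : F, ∃ φ : (Fin n → ℝ) [⋀^Fin T]→ₗ[ℝ] ℝ,
      (∀ e : Fin T → Fin n, (B G).card < (Finset.univ.filter fun j => r ≤ (e j : ℕ)).card →
        φ (fun j => Pi.single (e j) 1) = 0) ∧
      (∀ g : Fin T → Fin n, φ (fun j => momentPoint (g j)) ≠ 0 →
        (∀ b ∈ B G, ∃ j, g j = b) ∧ ∀ j, g j ∉ (G.1 ∪ V G)ᶜ) ∧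
      (∀ g : Fin T → Fin n, Function.Injective g → (∀ j, g j ∈ G.1) →
        φ (fun j => momentPoint (g j)) ≠ 0) := by
    intro G
    refine exists_alternating (hF _ G.2) (hB _ G.2) ?_ ?_ (by omega)
    · exact Finset.disjoint_left.2 fun x hx h => by
        rw [Finset.mem_compl] at h; exact h (Finset.mem_union_left _ hx)
    · rw [Finset.card_compl, Finset.card_union_of_disjoint (hV _ G.2), hF _ G.2, hVc _ G.2,
        hBc _ G.2, Fintype.card_fin]
      omega
  choose φ hφ0 hφ1 hφ2 using hex
  set 𝓡 := (Finset.univ.powersetCard T).filter fun R : Finset (Fin n) =>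
      (R.filter fun e : Fin n => r ≤ (e : ℕ)).card ≤ k with h𝓡
  have h𝓡c : ∀ R : 𝓡, R.1.card = T := fun R =>
    (Finset.mem_powersetCard.1 (Finset.mem_filter.1 R.2).1).2
  let Φ : F → (𝓡 → ℝ) := fun G R => φ G fun j => Pi.single (R.1.orderEmbOfFin (h𝓡c R) j) 1
  have hli : LinearIndependent ℝ Φ := by
    rw [Fintype.linearIndependent_iff]
    intro c hc
    have hsum : ∀ x, (∑ G, c G • φ G) x = ∑ G, c G • φ G x := fun x => by
      have h : ∀ s : Finset F, (∑ G ∈ s, c G • φ G) x = ∑ G ∈ s, c G • φ G x := fun s => by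
        induction s using Finset.induction_on with
        | empty => simp
        | insert a s ha ih => rw [Finset.sum_insert ha, Finset.sum_insert ha,
            AlternatingMap.add_apply, ih, AlternatingMap.smul_apply]
      exact h _
    have hzero : ∑ G, c G • φ G = 0 := by
      -- Only injective coordinate tuples matter. Those with more than `k` high indices give zero
      -- for every form; any other is a permutation of the increasing enumeration of some `R ∈ 𝓡`.
      refine Module.Basis.ext_alternating (Pi.basisFun ℝ (Fin n)) fun e he => ?_
      simp only [Pi.basisFun_apply]
      rw [AlternatingMap.zero_apply, hsum]
      by_cases hb : k < (Finset.univ.filter fun j => r ≤ (e j : ℕ)).card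
      · exact Finset.sum_eq_zero fun G _ => by rw [hφ0 G e (by rwa [hBc _ G.2]), smul_zero]
      · rw [not_lt] at hb
        set R := Finset.univ.image e with hR
        have hRc : R.card = T := by rw [hR, Finset.card_image_of_injective _ he]; simp
        have hRm : R ∈ 𝓡 := by
          rw [h𝓡, Finset.mem_filter, Finset.mem_powersetCard]
          refine ⟨⟨Finset.subset_univ _, hRc⟩, ?_⟩
          rw [hR, Finset.filter_image, Finset.card_image_of_injective _ he]
          exact hb
        have hperm : ∃ σ : Equiv.Perm (Fin T), ∀ j, e j = R.orderEmbOfFin hRc (σ j) := by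
          have : ∀ j, ∃ j', R.orderEmbOfFin hRc j' = e j := by
            intro j
            have : e j ∈ Set.range (R.orderEmbOfFin hRc) := by
              rw [Finset.range_orderEmbOfFin]; simp [hR]
            exact this
          choose σ hσ using this
          have hinj : Function.Injective σ := fun x y h => he (by rw [← hσ, ← hσ, h])
          exact ⟨Equiv.ofBijective σ (Finite.injective_iff_bijective.1 hinj),
            fun j => (hσ j).symm⟩
        obtain ⟨σ, hσ⟩ := hperm
        have h1 := congrFun hc ⟨R, hRm⟩
        simp only [Finset.sum_apply, Pi.smul_apply, Pi.zero_apply, Φ] at h1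
        have h2 : ∀ G, φ G (fun j => Pi.single (e j) 1) = Equiv.Perm.sign σ •
            φ G (fun j => Pi.single (R.orderEmbOfFin hRc j) 1) := by
          intro G
          rw [← AlternatingMap.map_perm]
          congr 1
          funext j
          simp [hσ]
        simp only [h2]
        rw [← smul_zero (Equiv.Perm.sign σ), ← h1, Finset.smul_sum]
        exact Finset.sum_congr rfl fun G _ => smul_comm _ _ _
    by_contra! hne
    obtain ⟨G₁, hG₁⟩ := hne
    -- Evaluate the relation on the moment points of a `w`-minimal `G₀` in its support: another
    -- surviving form would have smaller weight, so only the nonzero term of `G₀` remains.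
    obtain ⟨G₀, hG₀, hmin⟩ := Finset.exists_min_image
      (Finset.univ.filter fun G => c G ≠ 0) (fun G => w G.1) ⟨G₁, by simpa using hG₁⟩
    have hcG₀ : c G₀ ≠ 0 := (Finset.mem_filter.1 hG₀).2
    let g : Fin T → Fin n := G₀.1.orderEmbOfFin (hF _ G₀.2)
    have h1 := congrArg (fun ψ => ψ fun j => momentPoint (g j)) hzero
    simp only [AlternatingMap.zero_apply, hsum] at h1
    have hgr : ∀ i, (∃ j, g j = i) ↔ i ∈ G₀.1 := by
      intro i
      have := Finset.range_orderEmbOfFin G₀.1 (hF _ G₀.2)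
      rw [← Finset.mem_coe, ← this]; rfl
    rw [Finset.sum_eq_single G₀] at h1
    · rcases smul_eq_zero.1 h1 with h | h
      · exact hcG₀ h
      · exact hφ2 G₀ g (Finset.orderEmbOfFin _ _).injective (fun j => (hgr _).1 ⟨j, rfl⟩) h
    · intro G _ hGne
      by_cases hcG : c G = 0
      · rw [hcG, zero_smul]
      refine smul_eq_zero.2 (Or.inr ?_)
      by_contra hφne
      obtain ⟨hb1, hb2⟩ := hφ1 G g hφne
      rcases hskew G G.2 G₀ G₀.2 (fun b hb => (hgr b).1 (hb1 b hb)) (fun i hi => by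
        obtain ⟨j, rfl⟩ := (hgr i).2 hi
        simpa only [Finset.mem_compl, not_not] using hb2 j) with h | h
      · exact hGne (Subtype.ext h.symm)
      · exact (hmin G (by simpa using hcG)).not_gt h
    · simp
  have := hli.fintype_card_le_finrank
  simpa using this

/-! ### From sets to words: the binomial tail. -/

theorem card_filter_fun_eq {T n : ℕ} (Y : Finset (Fin n)) (k : ℕ) :
    (Finset.univ.filter fun f : Fin T → Fin n =>
      (Finset.univ.filter fun j => f j ∈ Y).card ≤ k).card
      = ∑ i ∈ Finset.range (k + 1), T.choose i * Y.card ^ i * (n - Y.card) ^ (T - i) := by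
  classical
  have hI : ∀ I : Finset (Fin T), (Finset.univ.filter fun f : Fin T → Fin n =>
      (Finset.univ.filter fun j => f j ∈ Y) = I).card
        = Y.card ^ I.card * (n - Y.card) ^ (T - I.card) := by
    intro I
    have : (Finset.univ.filter fun f : Fin T → Fin n =>
        (Finset.univ.filter fun j => f j ∈ Y) = I)
        = Fintype.piFinset fun j => if j ∈ I then Y else Yᶜ := by
      ext f
      simp only [Finset.mem_filter, Finset.mem_univ, true_and, Fintype.mem_piFinset,
        Finset.ext_iff]
      refine forall_congr' fun j => ?_
      by_cases hj : j ∈ I <;> simp [hj]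
    rw [this, Fintype.card_piFinset]
    simp only [apply_ite Finset.card]
    rw [Finset.prod_ite, Finset.prod_const, Finset.prod_const, Finset.card_compl,
      Fintype.card_fin]
    congr 2
    · simp
    · rw [← Finset.compl_filter]
      simp [Finset.card_compl]
  have hcong : ∀ f : Fin T → Fin n, (Finset.univ.filter fun j => f j ∈ Y).card ≤ k ↔
      (Finset.univ.filter fun j => f j ∈ Y).card ∈ Finset.range (k + 1) := fun f => by
    rw [Finset.mem_range, Nat.lt_succ_iff]
  rw [Finset.filter_congr fun f _ => hcong f]
  rw [Finset.card_eq_sum_card_fiberwise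
    (f := fun f : Fin T → Fin n => (Finset.univ.filter fun j => f j ∈ Y).card)
    (t := Finset.range (k + 1)) (fun f hf => by simpa using hf)]
  refine Finset.sum_congr rfl fun i hi => ?_
  rw [Finset.card_eq_sum_card_fiberwise
    (f := fun f : Fin T → Fin n => (Finset.univ.filter fun j => f j ∈ Y))
    (t := Finset.univ.powersetCard i) (fun f hf => by
      simp only [Finset.coe_filter, Set.mem_ofPred_eq] at hf
      simp [Finset.mem_powersetCard, hf.2])]
  rw [Finset.sum_congr rfl (g := fun _ => Y.card ^ i * (n - Y.card) ^ (T - i))]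
  · rw [Finset.sum_const, Finset.card_powersetCard]; simp [mul_assoc]
  · intro I hI'
    rw [Finset.mem_powersetCard] at hI'
    rw [← hI'.2, ← hI I]
    congr 1
    ext f
    simp only [Finset.mem_filter, Finset.mem_univ, true_and]
    constructor
    · exact fun h => h.2
    · intro h
      rw [h]
      exact ⟨⟨by rw [hI'.2]; exact hi, rfl⟩, rfl⟩

/-- The `T!` orderings of each set are distinct injective words, and the words determine the set. -/
theorem card_sets_mul_factorial_le {T n : ℕ} (Y : Finset (Fin n)) (k : ℕ) :
    ((Finset.univ.powersetCard T).filter fun R : Finset (Fin n) =>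
      (R.filter fun e => e ∈ Y).card ≤ k).card * T.factorial
      ≤ (Finset.univ.filter fun f : Fin T → Fin n =>
      (Finset.univ.filter fun j => f j ∈ Y).card ≤ k).card := by
  classical
  set 𝓡 := (Finset.univ.powersetCard T).filter fun R : Finset (Fin n) =>
      (R.filter fun e => e ∈ Y).card ≤ k with h𝓡
  have h𝓡c : ∀ R : 𝓡, R.1.card = T := fun R =>
    (Finset.mem_powersetCard.1 (Finset.mem_filter.1 R.2).1).2
  let Ψ : 𝓡 × Equiv.Perm (Fin T) → (Fin T → Fin n) :=
    fun x j => x.1.1.orderEmbOfFin (h𝓡c x.1) (x.2 j)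
  have himg : ∀ x, Finset.univ.image (Ψ x) = x.1.1 := by
    intro x
    ext i
    rw [← Finset.mem_coe (s := x.1.1), ← Finset.range_orderEmbOfFin x.1.1 (h𝓡c x.1)]
    simp only [Finset.mem_image, Finset.mem_univ, true_and, Set.mem_range, Ψ]
    exact ⟨fun ⟨j, h⟩ => ⟨_, h⟩, fun ⟨j, h⟩ => ⟨x.2.symm j, by simpa using h⟩⟩
  have hΨi : ∀ x, Function.Injective (Ψ x) := fun x =>
    (Finset.orderEmbOfFin _ _).injective.comp x.2.injective
  have hinj : Function.Injective Ψ := by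
    rintro ⟨R, σ⟩ ⟨R', σ'⟩ h
    have h1 : R = R' := Subtype.ext (by rw [← himg (R, σ), h, himg])
    subst h1
    have h2 : σ = σ' := Equiv.ext fun j =>
      (R.1.orderEmbOfFin (h𝓡c R)).injective (congrFun h j)
    rw [h2]
  have hcard : 𝓡.card * T.factorial = Fintype.card (𝓡 × Equiv.Perm (Fin T)) := by
    simp [Fintype.card_perm]
  rw [hcard, ← Finset.card_univ]
  refine Finset.card_le_card_of_injOn Ψ (fun x _ => ?_) hinj.injOn
  simp only [Finset.coe_filter, Finset.mem_univ, true_and, Set.mem_ofPred_eq]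
  have := (Finset.mem_filter.1 x.1.2).2
  rw [← himg x, Finset.filter_image, Finset.card_image_of_injective _ (hΨi x)] at this
  exact this

/-- The high indices form a set of size `v + k`, which a uniform letter hits with probability `(v +
k) / n`; the word count is therefore `n ^ T` times a binomial tail. -/
theorem card_mul_factorial_le_of_skew {n T k v : ℕ} {α : Type*} [LinearOrder α]
    (F : Finset (Finset (Fin n))) (B V : Finset (Fin n) → Finset (Fin n))
    (w : Finset (Fin n) → α) (hTv : T + v ≤ n) (hkT : k ≤ T)
    (hF : ∀ G ∈ F, G.card = T) (hB : ∀ G ∈ F, B G ⊆ G) (hBc : ∀ G ∈ F, (B G).card = k)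
    (hV : ∀ G ∈ F, Disjoint G (V G)) (hVc : ∀ G ∈ F, (V G).card = v)
    (hskew : ∀ G ∈ F, ∀ G' ∈ F, B G ⊆ G' → G' ⊆ G ∪ V G → G' = G ∨ w G < w G') :
    (F.card : ℝ) * T.factorial
      ≤ (n : ℝ) ^ T * binomialTail (k + 1) T (((v + k : ℕ) : ℝ) / n) := by
  set Y : Finset (Fin n) := Finset.univ.filter fun e : Fin n => n - v - k ≤ (e : ℕ) with hY
  have hYc : Y.card = v + k := by
    have h1 : Y = (Finset.univ.filter fun e : Fin n => (e : ℕ) < n - v - k)ᶜ := by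
      ext e; simp [hY]
    rw [h1, Finset.card_compl, Fin.card_filter_val_lt, Fintype.card_fin]
    omega
  have h1 := card_le_of_skew F B V w hTv hkT hF hB hBc hV hVc hskew
  have h2 := card_sets_mul_factorial_le (T := T) Y k
  rw [card_filter_fun_eq, hYc] at h2
  have h3 : F.card * T.factorial
      ≤ ∑ i ∈ Finset.range (k + 1), T.choose i * (v + k) ^ i * (n - (v + k)) ^ (T - i) := by
    refine le_trans (Nat.mul_le_mul_right _ (h1.trans (le_of_eq ?_))) h2
    congr 1
    ext R
    simp [hY]
  have h4 : ((F.card * T.factorial : ℕ) : ℝ) ≤ _ := Nat.cast_le.2 h3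
  push_cast at h4
  refine h4.trans (le_of_eq ?_)
  rw [binomialTail, Finset.mul_sum]
  refine Finset.sum_congr rfl fun i hi => ?_
  have hiT : i ≤ T := by rw [Finset.mem_range] at hi; omega
  rcases Nat.eq_zero_or_pos n with hn | hn
  · obtain rfl : T = 0 := by omega
    obtain rfl : i = 0 := by omega
    simp
  have hn' : (n : ℝ) ≠ 0 := by positivity
  rw [Nat.cast_sub (by omega)]
  obtain ⟨m, rfl⟩ := Nat.exists_eq_add_of_le hiT
  rw [Nat.add_sub_cancel_left, pow_add]
  push_cast
  rw [show (n : ℝ) - (v + k) = n * (1 - (v + k) / n) by field_simp, mul_pow, div_pow]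
  field_simp

/-! ### Ghost sample, exchangeability and the limit. -/

section Probability

open ProbabilityTheory

variable {S : Type*} [MeasurableSpace S]

/-- Chebyshev's inequality; each indicator has variance at most `1 / 4`. -/
theorem measure_count_le (P : Measure S) [IsProbabilityMeasure P] {A : Set S}
    [DecidablePred (· ∈ A)] (hA : MeasurableSet A) (M : ℕ) (hM : 0 < M) {δ : ℝ} (hδ : 0 < δ) :
    (Measure.pi fun _ : Fin M => P).real
      {x | ((Finset.univ.filter fun j => x j ∈ A).card : ℝ) ≤ (P.real A - δ) * M}
      ≤ 1 / (4 * δ ^ 2 * M) := by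
  set X : S → ℝ := A.indicator 1 with hX
  have hXm : Measurable X := measurable_one.indicator hA
  have hXb : ∀ s, X s ∈ Set.Icc (0 : ℝ) 1 := fun s => by
    by_cases h : s ∈ A <;> simp [hX, h]
  have hX2 : MemLp X 2 P := MemLp.of_bound hXm.aestronglyMeasurable 1
    (Filter.Eventually.of_forall fun s => by
      rw [Real.norm_of_nonneg (hXb s).1]; exact (hXb s).2)
  set μ := Measure.pi fun _ : Fin M => P
  set Z : (Fin M → S) → ℝ := ∑ j, fun x => X (x j) with hZ
  have hZ2 : MemLp Z 2 μ := memLp_finsetSum' _ fun j _ =>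
    hX2.comp_measurePreserving (measurePreserving_eval _ j)
  have hvar : variance Z μ ≤ M / 4 := by
    rw [hZ, variance_sum_pi fun _ => hX2]
    calc _ ≤ ∑ _j : Fin M, ((1 - 0 : ℝ) / 2) ^ 2 := Finset.sum_le_sum fun j _ =>
          variance_le_sq_of_bounded (Filter.Eventually.of_forall hXb) hXm.aemeasurable
      _ = _ := by simp; ring
  have hmean : ∫ x, Z x ∂μ = P.real A * M := by
    simp only [hZ, Finset.sum_apply]
    have hint : ∀ j ∈ Finset.univ, Integrable (fun x : Fin M → S => X (x j)) μ := fun j _ =>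
      (hX2.comp_measurePreserving
        (measurePreserving_eval (fun _ : Fin M => P) j)).integrable one_le_two
    rw [integral_finsetSum _ hint]
    have : ∀ j : Fin M, ∫ x, X (x j) ∂μ = P.real A := fun j => by
      have := (measurePreserving_eval (fun _ : Fin M => P) j).map_eq
      rw [← integral_indicator_one hA, ← this, integral_map (measurable_pi_apply j).aemeasurable]
      exact hXm.aestronglyMeasurable
    simp [this, mul_comm]
  have hM' : (0 : ℝ) < M := by exact_mod_cast hM
  have hc : 0 < δ * M := by positivity
  have hsub : {x : Fin M → S | ((Finset.univ.filter fun j => x j ∈ A).card : ℝ)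
      ≤ (P.real A - δ) * M} ⊆ {x | δ * M ≤ |Z x - ∫ x, Z x ∂μ|} := by
    intro x hx
    have hZx : Z x = ((Finset.univ.filter fun j => x j ∈ A).card : ℝ) := by
      simp [hZ, hX, Set.indicator_apply, Finset.sum_boole]
    simp only [Set.mem_ofPred_eq] at hx ⊢
    rw [hZx, hmean, le_abs]
    right
    linarith
  calc μ.real _ ≤ μ.real {x | δ * M ≤ |Z x - ∫ x, Z x ∂μ|} := measureReal_mono hsub
    _ ≤ variance Z μ / (δ * M) ^ 2 := by
        refine ENNReal.toReal_le_of_le_ofReal ?_ (meas_ge_le_variance_div_sq hZ2 hc)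
        exact div_nonneg (variance_nonneg _ _) (by positivity)
    _ ≤ (M / 4) / (δ * M) ^ 2 := by gcongr
    _ = 1 / (4 * δ ^ 2 * M) := by field_simp

/-- Splitting a sample along a set of indices. -/
noncomputable def splitEquiv (S : Type*) [MeasurableSpace S] {n T M : ℕ} {G : Finset (Fin n)}
    (hT : G.card = T) (hM : Gᶜ.card = M) : ((Fin T → S) × (Fin M → S)) ≃ᵐ (Fin n → S) :=
  (MeasurableEquiv.sumPiEquivProdPi fun _ : Fin T ⊕ Fin M => S).symm.trans
    (MeasurableEquiv.piCongrLeft (fun _ : Fin n => S) (finSumEquivOfFinset hT hM))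

theorem splitEquiv_apply_inl {n T M : ℕ} {G : Finset (Fin n)} (hT : G.card = T)
    (hM : Gᶜ.card = M) (x : (Fin T → S) × (Fin M → S)) (j : Fin T) :
    splitEquiv S hT hM x (G.orderEmbOfFin hT j) = x.1 j :=
  MeasurableEquiv.piCongrLeft_apply_apply (finSumEquivOfFinset hT hM) (β := fun _ => S)
    _ (Sum.inl j)

theorem splitEquiv_apply_inr {n T M : ℕ} {G : Finset (Fin n)} (hT : G.card = T)
    (hM : Gᶜ.card = M) (x : (Fin T → S) × (Fin M → S)) (j : Fin M) :
    splitEquiv S hT hM x (Gᶜ.orderEmbOfFin hM j) = x.2 j :=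
  MeasurableEquiv.piCongrLeft_apply_apply (finSumEquivOfFinset hT hM) (β := fun _ => S)
    _ (Sum.inr j)

theorem measurePreserving_splitEquiv (P : Measure S) [IsProbabilityMeasure P] {n T M : ℕ}
    {G : Finset (Fin n)} (hT : G.card = T) (hM : Gᶜ.card = M) :
    MeasurePreserving (splitEquiv S hT hM)
      ((Measure.pi fun _ : Fin T => P).prod (Measure.pi fun _ : Fin M => P))
      (Measure.pi fun _ : Fin n => P) :=
  (measurePreserving_sumPiEquivProdPi_symm fun _ : Fin T ⊕ Fin M => P).trans
    (measurePreserving_piCongrLeft (fun _ : Fin n => P) (finSumEquivOfFinset hT hM))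

/-- Each of the finitely many sub-samples has the product law. This makes all `T`-subset programs
uniquely solvable at once. -/
theorem ae_comp_orderEmbOfFin (P : Measure S) [IsProbabilityMeasure P] {n T : ℕ}
    {Q : (Fin T → S) → Prop} (hQ : ∀ᵐ s ∂(Measure.pi fun _ : Fin T => P), Q s) :
    ∀ᵐ ω ∂(Measure.pi fun _ : Fin n => P), ∀ (G : Finset (Fin n)) (hG : G.card = T),
      Q fun j => ω (G.orderEmbOfFin hG j) := by
  rw [ae_all_iff]
  intro G
  by_cases hG : G.card = T
  · have hmp := measurePreserving_splitEquiv P hG rfl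
    rw [← hmp.map_eq, (splitEquiv S hG rfl).measurableEmbedding.ae_map_iff]
    have := (Measure.quasiMeasurePreserving_fst (μ := Measure.pi fun _ : Fin T => P)
      (ν := Measure.pi fun _ : Fin (Gᶜ.card) => P)).ae hQ
    filter_upwards [this] with x hx _
    simpa only [splitEquiv_apply_inl] using hx
  · exact Filter.Eventually.of_forall fun _ h => absurd h hG

variable {α : Type*}

open Classical in
/-- The number of sample points outside `G` at which `g` of the sample points in `G` is
violated. -/
noncomputable def violCount {n T : ℕ} (g : (Fin T → S) → α) (Vi : Set (α × S))
    (G : Finset (Fin n)) (hG : G.card = T) (ω : Fin n → S) : ℕ :=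
  (Gᶜ.filter fun i => (g fun j => ω (G.orderEmbOfFin hG j), ω i) ∈ Vi).card

open Classical in
theorem violCount_splitEquiv {n T M : ℕ} (g : (Fin T → S) → α) (Vi : Set (α × S))
    {G : Finset (Fin n)} (hG : G.card = T) (hM : Gᶜ.card = M)
    (x : (Fin T → S) × (Fin M → S)) :
    violCount g Vi G hG (splitEquiv S hG hM x)
      = (Finset.univ.filter fun j => (g x.1, x.2 j) ∈ Vi).card := by
  simp only [violCount, splitEquiv_apply_inl]
  have : Gᶜ = Finset.univ.map (Gᶜ.orderEmbOfFin hM).toEmbedding := by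
    rw [← Finset.coe_inj]; simp
  conv_lhs => rw [this, Finset.filter_map, Finset.card_map]
  congr 1
  ext j
  simp [splitEquiv_apply_inr]

variable [MeasurableSpace α]

theorem measurableSet_violCount {n T : ℕ} {g : (Fin T → S) → α} (hg : Measurable g)
    {Vi : Set (α × S)} (hVi : MeasurableSet Vi) (G : Finset (Fin n)) (hG : G.card = T) (v : ℕ) :
    MeasurableSet {ω : Fin n → S | v ≤ violCount g Vi G hG ω} := by
  classical
  simp only [violCount, Finset.card_filter]
  refine measurableSet_le measurable_const (Finset.measurable_sum _ fun i _ => ?_)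
  refine Measurable.ite ?_ measurable_const measurable_const
  exact ((hg.comp (by fun_prop)).prodMk (measurable_pi_apply i)) hVi

open Classical in
/-- If, for almost every sample of size `T + M`, few `T`-subsets have `v` violators, then few
samples of size `T` have a violation probability exceeding `v / M` noticeably. -/
theorem measureReal_mul_choose_le (P : Measure S) [IsProbabilityMeasure P] {T M v : ℕ}
    (hM : 0 < M) {g : (Fin T → S) → α} (hg : Measurable g) {Vi : Set (α × S)}
    (hVi : MeasurableSet Vi) {N ε ε' : ℝ} (hε : ε' < ε) (hv : ∀ c : ℕ, c < v → c ≤ ε' * M)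
    (hN : ∀ᵐ ω ∂(Measure.pi fun _ : Fin (T + M) => P),
      (((Finset.univ.powersetCard T).filter fun G : Finset (Fin (T + M)) =>
        ∃ hG : G.card = T, v ≤ violCount g Vi G hG ω).card : ℝ) ≤ N) :
    (Measure.pi fun _ : Fin T => P).real {s | ε < P.real {z | (g s, z) ∈ Vi}}
      * (1 - 1 / (4 * (ε - ε') ^ 2 * M)) * ((T + M).choose T : ℝ) ≤ N := by
  set μ := Measure.pi fun _ : Fin (T + M) => P
  set μT := Measure.pi fun _ : Fin T => P
  set μM := Measure.pi fun _ : Fin M => P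
  set D : Set ((Fin T → S) × (Fin M → S)) :=
    {x | v ≤ (Finset.univ.filter fun j => (g x.1, x.2 j) ∈ Vi).card} with hD
  have hsec : ∀ s : Fin T → S, MeasurableSet {z | (g s, z) ∈ Vi} := fun s =>
    measurable_prodMk_left hVi
  have hGc : ∀ G : Finset (Fin (T + M)), G.card = T → Gᶜ.card = M := fun G hG => by
    rw [Finset.card_compl, hG, Fintype.card_fin]; omega
  have hED : ∀ (G : Finset (Fin (T + M))) (hG : G.card = T),
      splitEquiv S hG (hGc G hG) ⁻¹' {ω | v ≤ violCount g Vi G hG ω} = D := fun G hG => by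
    ext x
    simp only [Set.mem_preimage, Set.mem_ofPred_eq, violCount_splitEquiv, hD]
  have hE : ∀ (G : Finset (Fin (T + M))) (hG : G.card = T),
      μ.real {ω | v ≤ violCount g Vi G hG ω} = (μT.prod μM).real D := fun G hG => by
    rw [measureReal_def, measureReal_def, ← hED G hG,
      (measurePreserving_splitEquiv P hG (hGc G hG)).measure_preimage_equiv]
  have hDm : MeasurableSet D := by
    obtain ⟨G, _, hG⟩ := Finset.exists_subset_card_eq
      (s := (Finset.univ : Finset (Fin (T + M)))) (n := T) (by simp)
    rw [← hED G hG]
    exact (splitEquiv S hG (hGc G hG)).measurable (measurableSet_violCount hg hVi G hG v)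
  -- By exchangeability every `T`-subset is bad with the same probability, so the left side is the
  -- expected number of bad subsets.
  have hupper : (μT.prod μM).real D * ((T + M).choose T : ℝ) ≤ N := by
    set 𝓖 := (Finset.univ : Finset (Fin (T + M))).powersetCard T with h𝓖
    let E : Finset (Fin (T + M)) → Set (Fin (T + M) → S) :=
      fun G => {ω | ∃ hG : G.card = T, v ≤ violCount g Vi G hG ω}
    have hEG : ∀ G (hG : G.card = T), E G = {ω | v ≤ violCount g Vi G hG ω} := fun G hG => by
      ext ω; simp [E, hG]
    have hcard : ∀ G ∈ 𝓖, G.card = T := fun G hG => (Finset.mem_powersetCard.1 hG).2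
    have hEm : ∀ G ∈ 𝓖, MeasurableSet (E G) := fun G hG => by
      rw [hEG G (hcard G hG)]
      exact measurableSet_violCount hg hVi G _ v
    have hint : ∀ G ∈ 𝓖, Integrable ((E G).indicator (1 : (Fin (T + M) → S) → ℝ)) μ := fun G hG =>
      (integrable_const (1 : ℝ)).indicator (hEm G hG)
    calc (μT.prod μM).real D * ((T + M).choose T : ℝ)
        = ∑ G ∈ 𝓖, μ.real (E G) := by
          rw [Finset.sum_congr rfl fun G hG => by rw [hEG G (hcard G hG), hE G (hcard G hG)]]
          simp [h𝓖, mul_comm]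
      _ = ∫ ω, ∑ G ∈ 𝓖, (E G).indicator (1 : (Fin (T + M) → S) → ℝ) ω ∂μ := by
          rw [integral_finsetSum _ hint]
          exact Finset.sum_congr rfl fun G hG => (integral_indicator_one (hEm G hG)).symm
      _ ≤ ∫ _, N ∂μ := by
          refine integral_mono_ae (integrable_finsetSum _ hint) (integrable_const _) ?_
          filter_upwards [hN] with ω hω
          refine le_trans (le_of_eq ?_) hω
          simp [Set.indicator_apply, Finset.sum_boole, E]
      _ = N := by simp
  -- Fubini: with the training sample fixed in `W`, the ghost count concentrates above `v` by
  -- `measure_count_le`.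
  have hlower : μT.real {s | ε < P.real {z | (g s, z) ∈ Vi}}
      * (1 - 1 / (4 * (ε - ε') ^ 2 * M)) ≤ (μT.prod μM).real D := by
    set W := {s | ε < P.real {z | (g s, z) ∈ Vi}} with hW
    have hWm : MeasurableSet W := by
      refine measurableSet_lt measurable_const ?_
      exact (measurable_measure_prodMk_left
        (((hg.comp measurable_fst).prodMk measurable_snd) hVi)).ennreal_toReal
    have hDs : (μT.prod μM).real D = ∫ s, μM.real (Prod.mk s ⁻¹' D) ∂μT := by
      rw [measureReal_def, Measure.prod_apply hDm, integral_eq_lintegral_of_nonneg_ae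
        (Filter.Eventually.of_forall fun _ => measureReal_nonneg)
        (measurable_measure_prodMk_left hDm).ennreal_toReal.aestronglyMeasurable]
      simp
    have hint : Integrable (fun s => μM.real (Prod.mk s ⁻¹' D)) μT :=
      Integrable.of_bound
        (measurable_measure_prodMk_left hDm).ennreal_toReal.aestronglyMeasurable 1
        (Filter.Eventually.of_forall fun s => by
          rw [Real.norm_of_nonneg measureReal_nonneg]; exact measureReal_le_one)
    rw [hDs, ← smul_eq_mul, ← integral_indicator_const _ hWm]
    refine integral_mono ((integrable_const _).indicator hWm) hint fun s => ?_
    by_cases hs : s ∈ W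
    · rw [Set.indicator_of_mem hs]
      have h1 := measure_count_le P (hsec s) M hM (sub_pos.2 hε)
      have h2 : (Prod.mk s ⁻¹' D)ᶜ ⊆ {x : Fin M → S | ((Finset.univ.filter fun j =>
          x j ∈ {z | (g s, z) ∈ Vi}).card : ℝ)
            ≤ (P.real {z | (g s, z) ∈ Vi} - (ε - ε')) * M} := by
        intro x hx
        simp only [hD, Set.mem_compl_iff, Set.mem_preimage, Set.mem_ofPred_eq, not_le] at hx ⊢
        refine (hv _ hx).trans (mul_le_mul_of_nonneg_right ?_ (Nat.cast_nonneg _))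
        have : ε < P.real {z | (g s, z) ∈ Vi} := hs
        linarith
      have h3 := (measureReal_mono (μ := μM) h2).trans h1
      rw [probReal_compl_eq_one_sub (measurable_prodMk_left hDm)] at h3
      dsimp only
      linarith
    · rw [Set.indicator_of_notMem hs]
      exact measureReal_nonneg
  exact (mul_le_mul_of_nonneg_right hlower (Nat.cast_nonneg _)).trans hupper

theorem continuous_binomialTail (d n : ℕ) : Continuous (binomialTail d n) := by
  unfold binomialTail
  fun_prop

-- Let `M → ∞` in the finite count; neither the set-to-word comparison nor the ghost sample costs
-- anything in the limit.
open Filter Topology in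
open Classical in
theorem measureReal_lt_le_binomialTail (P : Measure S) [IsProbabilityMeasure P] {T k : ℕ}
    {g : (Fin T → S) → α} (hg : Measurable g) {Vi : Set (α × S)} (hVi : MeasurableSet Vi)
    {ε : ℝ} (hε0 : 0 < ε) (hε1 : ε ≤ 1)
    (hN : ∀ M v : ℕ, v ≤ M → ∀ᵐ ω ∂(Measure.pi fun _ : Fin (T + M) => P),
      (((Finset.univ.powersetCard T).filter fun G : Finset (Fin (T + M)) =>
        ∃ hG : G.card = T, v ≤ violCount g Vi G hG ω).card : ℝ) * T.factorial
        ≤ ((T + M : ℕ) : ℝ) ^ T * binomialTail (k + 1) T (((v + k : ℕ) : ℝ) / (T + M : ℕ))) :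
    (Measure.pi fun _ : Fin T => P).real {s | ε < P.real {z | (g s, z) ∈ Vi}}
      ≤ binomialTail (k + 1) T ε := by
  set p := (Measure.pi fun _ : Fin T => P).real {s | ε < P.real {z | (g s, z) ∈ Vi}} with hp
  have hp0 : 0 ≤ p := measureReal_nonneg
  -- The gap `ε - ε'` is what Chebyshev needs; continuity of the tail closes it at the end.
  have key : ∀ ε' ∈ Set.Ioo 0 ε, p ≤ binomialTail (k + 1) T ε' := by
    rintro ε' ⟨h0, h1⟩
    have hM : ∀ᶠ M : ℕ in atTop, p * (1 - 1 / (4 * (ε - ε') ^ 2 * M)) *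
        (((M : ℝ) + 1) / (T + M)) ^ T
        ≤ binomialTail (k + 1) T ((⌈ε' * M⌉₊ + k) / (T + M)) := by
      have hlarge : ∀ᶠ M : ℕ in atTop, 1 / (4 * (ε - ε') ^ 2) ≤ (M : ℝ) :=
        tendsto_natCast_atTop_atTop.eventually_ge_atTop _
      filter_upwards [eventually_gt_atTop 0, hlarge] with M hM hMl
      have hM' : (0 : ℝ) < M := by exact_mod_cast hM
      have hceil : ⌈ε' * M⌉₊ ≤ M := by
        rw [Nat.ceil_le]
        nlinarith
      have h2 := measureReal_mul_choose_le P (v := ⌈ε' * M⌉₊) hM hg hVi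
        (N := ((T + M : ℕ) : ℝ) ^ T
          * binomialTail (k + 1) T (((⌈ε' * M⌉₊ + k : ℕ) : ℝ) / (T + M : ℕ)) / T.factorial)
        h1 (fun c hc => (Nat.lt_ceil.1 hc).le) (by
          filter_upwards [hN M _ hceil] with ω hω
          rwa [le_div_iff₀ (by positivity)])
      rw [← hp, le_div_iff₀ (by positivity), mul_assoc, ← Nat.cast_mul, mul_comm _ T.factorial,
        ← Nat.descFactorial_eq_factorial_mul_choose] at h2
      -- Ordered `T`-tuples of distinct indices are asymptotically all `T`-tuples.
      have h3 : ((M : ℝ) + 1) ^ T ≤ ((T + M).descFactorial T : ℝ) := by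
        have := Nat.pow_sub_le_descFactorial (T + M) T
        rw [show T + M + 1 - T = M + 1 by omega] at this
        exact_mod_cast this
      have hc : 0 ≤ p * (1 - 1 / (4 * (ε - ε') ^ 2 * M)) := by
        refine mul_nonneg hp0 (sub_nonneg.2 ?_)
        have h4 : 0 < 4 * (ε - ε') ^ 2 := by have := sub_pos.2 h1; positivity
        rw [div_le_iff₀ (by positivity)]
        rw [div_le_iff₀ h4] at hMl
        linarith
      have h5 := (mul_le_mul_of_nonneg_left h3 hc).trans h2
      push_cast at h5
      have h6 : (0 : ℝ) < T + M := by positivity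
      rw [div_pow, ← mul_div_assoc, div_le_iff₀ (by positivity), mul_comm (binomialTail _ _ _)]
      exact h5
    have t1 : Tendsto (fun M : ℕ => 1 / (4 * (ε - ε') ^ 2 * (M : ℝ))) atTop (𝓝 0) := by
      have h4 : 0 < 4 * (ε - ε') ^ 2 := by have := sub_pos.2 h1; positivity
      refine Tendsto.div_atTop tendsto_const_nhds ?_
      exact tendsto_natCast_atTop_atTop.const_mul_atTop h4
    have tM : ∀ c : ℝ, Tendsto (fun M : ℕ => c / (M : ℝ)) atTop (𝓝 0) := fun c =>
      tendsto_const_div_atTop_nhds_zero_nat c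
    have t2 : Tendsto (fun M : ℕ => (((M : ℝ) + 1) / (T + M))) atTop (𝓝 1) := by
      have : Tendsto (fun M : ℕ => (1 + 1 / (M : ℝ)) / (T / (M : ℝ) + 1)) atTop
          (𝓝 ((1 + 0) / (0 + 1))) :=
        (((tM 1).const_add 1).div ((tM T).add_const 1) (by norm_num))
      rw [show ((1 : ℝ) + 0) / (0 + 1) = 1 by norm_num] at this
      refine this.congr' ?_
      filter_upwards [eventually_gt_atTop 0] with M hM
      have hM' : (0 : ℝ) < M := by exact_mod_cast hM
      field_simp
    have t3 : Tendsto (fun M : ℕ => ((⌈ε' * M⌉₊ + k : ℝ) / (T + M))) atTop (𝓝 ε') := by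
      have hc : Tendsto (fun M : ℕ => (⌈ε' * M⌉₊ : ℝ) / (M : ℝ)) atTop (𝓝 ε') :=
        (tendsto_nat_ceil_mul_div_atTop h0.le).comp tendsto_natCast_atTop_atTop
      have : Tendsto (fun M : ℕ => ((⌈ε' * M⌉₊ : ℝ) / (M : ℝ) + k / (M : ℝ)) / (T / (M : ℝ) + 1))
          atTop (𝓝 ((ε' + 0) / (0 + 1))) :=
        ((hc.add (tM k)).div ((tM T).add_const 1) (by norm_num))
      rw [show (ε' + 0) / (0 + 1) = ε' by norm_num] at this
      refine this.congr' ?_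
      filter_upwards [eventually_gt_atTop 0] with M hM
      have hM' : (0 : ℝ) < M := by exact_mod_cast hM
      field_simp
    have tl := (((t1.const_sub 1).const_mul p).mul (t2.pow T))
    have tr := ((continuous_binomialTail (k + 1) T).tendsto ε').comp t3
    simpa using le_of_tendsto_of_tendsto tl tr hM
  have hcont : Tendsto (binomialTail (k + 1) T) (𝓝[<] ε) (𝓝 (binomialTail (k + 1) T ε)) :=
    ((continuous_binomialTail (k + 1) T).tendsto ε).mono_left nhdsWithin_le_nhds
  exact ge_of_tendsto hcont (by
    filter_upwards [Ioo_mem_nhdsLT hε0] with ε' h using key ε' h)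

end Probability

/-! ### Convex geometry of optimizers: Helly bases and tie-breaking. -/

section Geometry

variable {E : Type*} [NormedAddCommGroup E] [InnerProductSpace ℝ E]

/-- The points of `Θ` which are better than `θ`, with ties in `J` broken by the norm. -/
def betterSet (Θ : Set E) (J : E → ℝ) (θ : E) : Set E :=
  {x | x ∈ Θ ∧ (J x < J θ ∨ J x = J θ ∧ ‖x‖ < ‖θ‖)}

/-- A proper combination involving a point of strictly smaller `J` has strictly smaller `J`;
otherwise both points tie in `J` and the triangle inequality keeps the norm strictly smaller. -/
theorem convex_betterSet {Θ : Set E} (hΘ : Convex ℝ Θ) {J : E → ℝ}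
    (hJ : ConvexOn ℝ Set.univ J) (θ : E) : Convex ℝ (betterSet Θ J θ) := by
  rintro x ⟨hxΘ, hx⟩ y ⟨hyΘ, hy⟩ a b ha hb hab
  refine ⟨hΘ hxΘ hyΘ ha hb hab, ?_⟩
  rcases ha.eq_or_lt with rfl | ha
  · obtain rfl : b = 1 := by linarith
    simpa using hy
  rcases hb.eq_or_lt with rfl | hb
  · obtain rfl : a = 1 := by linarith
    simpa using hx
  have h1 := hJ.2 (Set.mem_univ x) (Set.mem_univ y) ha.le hb.le hab
  simp only [smul_eq_mul] at h1
  have hb' : b = 1 - a := by linarith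
  have hx' : J x ≤ J θ := by rcases hx with h | h <;> linarith
  have hy' : J y ≤ J θ := by rcases hy with h | h <;> linarith
  have hxa := mul_le_mul_of_nonneg_left hx' ha.le
  have hyb := mul_le_mul_of_nonneg_left hy' hb.le
  have hs : a * J θ + b * J θ = J θ := by rw [← add_mul, hab, one_mul]
  rcases hx with hx | hx
  · left
    have := mul_lt_mul_of_pos_left hx ha
    linarith
  rcases hy with hy | hy
  · left
    have := mul_lt_mul_of_pos_left hy hb
    linarith
  rcases (show J (a • x + b • y) ≤ J θ by linarith).lt_or_eq with h | h
  · exact Or.inl h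
  · refine Or.inr ⟨h, (norm_add_le _ _).trans_lt ?_⟩
    rw [norm_smul, norm_smul, Real.norm_of_nonneg ha.le, Real.norm_of_nonneg hb.le]
    have h2 := mul_lt_mul_of_pos_left hx.2 ha
    have h3 := mul_lt_mul_of_pos_left hy.2 hb
    have hs : a * ‖θ‖ + b * ‖θ‖ = ‖θ‖ := by rw [← add_mul, hab, one_mul]
    linarith

variable [FiniteDimensional ℝ E]

/-- A convex set which meets each ray in at most one point does not span the space affinely. -/
theorem finrank_vectorSpan_lt {Θ : Set E} (hΘ : Convex ℝ Θ) (hne : Θ.Nonempty)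
    (hray : ∀ θ ∈ Θ, ∀ α : ℝ, α ≠ 1 → α • θ ∉ Θ) :
    Module.finrank ℝ (vectorSpan ℝ Θ) < Module.finrank ℝ E := by
  refine lt_of_le_of_ne (Submodule.finrank_le _) fun h => ?_
  -- Full affine span would give an interior point, whose multiples by factors near `1` stay in `Θ`.
  have h1 := Submodule.eq_top_of_finrank_eq h
  rw [← AffineSubspace.affineSpan_eq_top_iff_vectorSpan_eq_top_of_nonempty ℝ E E hne,
    ← hΘ.interior_nonempty_iff_affineSpan_eq_top] at h1
  obtain ⟨x, hx⟩ := h1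
  have hc : Filter.Tendsto (fun α : ℝ => α • x) (nhds 1) (nhds x) := by
    have : Continuous fun α : ℝ => α • x := by fun_prop
    simpa using this.tendsto 1
  have h2 : ∀ᶠ α : ℝ in nhdsWithin 1 {1}ᶜ, α • x ∈ Θ :=
    (hc.eventually (mem_interior_iff_mem_nhds.1 hx)).filter_mono nhdsWithin_le_nhds
  obtain ⟨α, hα, hα1⟩ := (h2.and self_mem_nhdsWithin).exists
  exact hray x (interior_subset hx) α hα1 hα

/-- Helly's theorem inside a convex set: an objective set `L` which misses the intersection of the
sets `K i` already misses the intersection of few of them. -/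
theorem exists_subset_inter_eq_empty {ι : Type*} {Θ L : Set E} {k : ℕ}
    (hk : Module.finrank ℝ (vectorSpan ℝ Θ) ≤ k) (K : ι → Set E) (hK : ∀ i, Convex ℝ (K i))
    (hL : Convex ℝ L) (hLΘ : L ⊆ Θ) {G : Finset ι} {θ : E} (hθ : θ ∈ Θ) (hθK : ∀ i ∈ G, θ ∈ K i)
    (hempty : ∀ x ∈ L, ∃ i ∈ G, x ∉ K i) :
    ∃ B ⊆ G, B.card ≤ k ∧ ∀ x ∈ L, ∃ i ∈ B, x ∉ K i := by
  classical
  by_contra! hcon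
  -- Pulling back to the direction space lowers the Helly number to at most `k + 1`.
  let τ : vectorSpan ℝ Θ →ᵃ[ℝ] E :=
    (vectorSpan ℝ Θ).subtype.toAffineMap + AffineMap.const ℝ _ θ
  have hτ : ∀ w, τ w = (w : E) + θ := fun w => rfl
  let F : Option ι → Set (vectorSpan ℝ Θ) := fun o => τ ⁻¹' o.elim L K
  obtain ⟨w, hw⟩ := Convex.helly_theorem' (𝕜 := ℝ) (F := F) (s := Finset.insertNone G)
    (fun o _ => by
      rcases o with _ | i
      · exact hL.affine_preimage τ
      · exact (hK i).affine_preimage τ)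
    (fun I hI hIc => by
      -- A subfamily containing `L` leaves room for at most `k` constraints, handled by `hcon`; one
      -- without `L` contains `θ`, that is, the origin.
      by_cases hnone : none ∈ I
      · obtain ⟨x, hxL, hx⟩ := hcon (Finset.eraseNone I)
          (fun i hi => by simpa using hI (Finset.mem_eraseNone.1 hi))
          (by rw [Finset.card_eraseNone_of_mem hnone]; omega)
        refine ⟨⟨x - θ, vsub_mem_vectorSpan ℝ (hLΘ hxL) hθ⟩, ?_⟩
        refine Set.mem_iInter₂.2 fun o ho => ?_
        change τ _ ∈ o.elim L K
        rw [hτ]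
        rcases o with _ | i
        · simpa using hxL
        · simpa using hx i (Finset.mem_eraseNone.2 ho)
      · refine ⟨0, Set.mem_iInter₂.2 fun o ho => ?_⟩
        change τ _ ∈ o.elim L K
        rw [hτ]
        rcases o with _ | i
        · exact absurd ho hnone
        · simpa using hθK i (by simpa using hI ho))
  rw [Set.mem_iInter₂] at hw
  obtain ⟨i, hi, hiK⟩ := hempty (τ w) (hw none (by simp))
  exact hiK (hw (some i) (by simpa using hi))

open Classical in
/-- Few of the subsets of `T` convex constraints have an optimizer which violates `v` or more of
the other constraints. -/
theorem card_mul_factorial_le_of_optimizer {n T k v : ℕ} {Θ : Set E} (hΘ : Convex ℝ Θ)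
    (hk : Module.finrank ℝ (vectorSpan ℝ Θ) ≤ k) {J : E → ℝ} (hJ : ConvexOn ℝ Set.univ J)
    (K : Fin n → Set E) (hK : ∀ i, Convex ℝ (K i)) (hTv : T + v ≤ n) (hkT : k ≤ T)
    (θ : Finset (Fin n) → E) (hθΘ : ∀ G, G.card = T → θ G ∈ Θ)
    (hθK : ∀ G, G.card = T → ∀ i ∈ G, θ G ∈ K i)
    (hmin : ∀ G, G.card = T → ∀ x ∈ Θ, (∀ i ∈ G, x ∈ K i) → J (θ G) ≤ J x)
    (huniq : ∀ G, G.card = T → ∀ x ∈ Θ, (∀ i ∈ G, x ∈ K i) → J x ≤ J (θ G) → x = θ G) :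
    (((Finset.univ.powersetCard T).filter fun G : Finset (Fin n) =>
        v ≤ (Gᶜ.filter fun i => θ G ∉ K i).card).card : ℝ) * T.factorial
      ≤ (n : ℝ) ^ T * binomialTail (k + 1) T (((v + k : ℕ) : ℝ) / n) := by
  have hbasis : ∀ G : Finset (Fin n), ∃ B : Finset (Fin n), G.card = T →
      B ⊆ G ∧ B.card = k ∧ ∀ x ∈ betterSet Θ J (θ G), ∃ i ∈ B, x ∉ K i := by
    intro G
    by_cases hG : G.card = T
    · obtain ⟨B, hB, hBc, hBx⟩ := exists_subset_inter_eq_empty hk K hK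
        (convex_betterSet hΘ hJ (θ G)) (fun x hx => hx.1) (hθΘ G hG) (hθK G hG) (by
          rintro x ⟨hxΘ, hx⟩
          by_contra! hxK
          rcases hx with hx | ⟨hx, hxn⟩
          · exact (hmin G hG x hxΘ hxK).not_gt hx
          · rw [huniq G hG x hxΘ hxK hx.le] at hxn
            exact lt_irrefl _ hxn)
      -- The set-pair bound needs bases of size exactly `k`; enlarging one keeps its exclusion
      -- property.
      obtain ⟨B', hBB', hB'G, hB'c⟩ := Finset.exists_subsuperset_card_eq hB hBc
        (by rw [hG]; exact hkT)
      exact ⟨B', fun _ => ⟨hB'G, hB'c, fun x hx => by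
        obtain ⟨i, hi, hix⟩ := hBx x hx
        exact ⟨i, hBB' hi, hix⟩⟩⟩
    · exact ⟨∅, fun h => absurd h hG⟩
  choose B hB using hbasis
  have hviol : ∀ G : Finset (Fin n), ∃ V : Finset (Fin n),
      v ≤ (Gᶜ.filter fun i => θ G ∉ K i).card →
        V ⊆ Gᶜ.filter (fun i => θ G ∉ K i) ∧ V.card = v := by
    intro G
    by_cases h : v ≤ (Gᶜ.filter fun i => θ G ∉ K i).card
    · obtain ⟨V, hV⟩ := Finset.exists_subset_card_eq h
      exact ⟨V, fun _ => hV⟩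
    · exact ⟨∅, fun h' => absurd h' h⟩
  choose V hV using hviol
  have hF : ∀ G ∈ (Finset.univ.powersetCard T).filter fun G : Finset (Fin n) =>
      v ≤ (Gᶜ.filter fun i => θ G ∉ K i).card,
      G.card = T ∧ v ≤ (Gᶜ.filter fun i => θ G ∉ K i).card := fun G hG => by
    rw [Finset.mem_filter, Finset.mem_powersetCard] at hG
    exact ⟨hG.1.2, hG.2⟩
  -- The norm enters the weight because uniqueness is available only with `T` constraints: for `B`
  -- alone, several points may share the optimal value.
  refine card_mul_factorial_le_of_skew _ B V (fun G => toLex (J (θ G), ‖θ G‖)) hTv hkT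
    (fun G hG => (hF G hG).1) (fun G hG => (hB G (hF G hG).1).1)
    (fun G hG => (hB G (hF G hG).1).2.1)
    (fun G hG => Finset.disjoint_left.2 fun i hi hiV => ?_)
    (fun G hG => (hV G (hF G hG).2).2) (fun G hG G' hG' hBG' hG'V => ?_)
  · exact Finset.mem_compl.1 (Finset.mem_filter.1 ((hV G (hF G hG).2).1 hiV)).1 hi
  · obtain ⟨hGT, hGv⟩ := hF G hG
    obtain ⟨hGT', -⟩ := hF G' hG'
    obtain ⟨-, -, hbetter⟩ := hB G hGT
    have hθ'B : ∀ i ∈ B G, θ G' ∈ K i := fun i hi => hθK G' hGT' i (hBG' hi)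
    have hnot : θ G' ∉ betterSet Θ J (θ G) := fun h => by
      obtain ⟨i, hi, hix⟩ := hbetter _ h
      exact hix (hθ'B i hi)
    rw [Prod.Lex.toLex_lt_toLex]
    by_contra! hcon
    obtain ⟨hne, hJle, hnle⟩ := hcon
    have hnot' : ¬ (J (θ G') < J (θ G) ∨ J (θ G') = J (θ G) ∧ ‖θ G'‖ < ‖θ G‖) :=
      fun h => hnot ⟨hθΘ G' hGT', h⟩
    push Not at hnot'
    have hJeq : J (θ G) = J (θ G') := le_antisymm hnot'.1 hJle
    have hneq : ‖θ G‖ = ‖θ G'‖ := le_antisymm (hnot'.2 hJeq.symm) (hnle hJeq)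
    have hθeq : θ G = θ G' := by
      by_contra hθne
      -- Two distinct points tied in `J` and norm have a midpoint that is better by strict convexity
      -- of the norm, yet satisfies all constraints in `B G`.
      have hmid : (1 / 2 : ℝ) • (θ G + θ G') ∈ betterSet Θ J (θ G) := by
        refine ⟨?_, ?_⟩
        · rw [smul_add]
          exact hΘ (hθΘ G hGT) (hθΘ G' hGT') (by norm_num) (by norm_num) (by norm_num)
        · have h1 := hJ.2 (Set.mem_univ (θ G)) (Set.mem_univ (θ G'))
            (show (0 : ℝ) ≤ 1 / 2 by norm_num) (show (0 : ℝ) ≤ 1 / 2 by norm_num) (by norm_num)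
          rw [← smul_add, ← hJeq, smul_eq_mul] at h1
          rcases (show J ((1 / 2 : ℝ) • (θ G + θ G')) ≤ J (θ G) by linarith).lt_or_eq with h | h
          · exact Or.inl h
          · exact Or.inr ⟨h, (norm_midpoint_lt_iff hneq).2 hθne⟩
      obtain ⟨i, hi, hix⟩ := hbetter _ hmid
      apply hix
      rw [smul_add]
      exact hK i (hθK G hGT i ((hB G hGT).1 hi)) (hθ'B i hi) (by norm_num) (by norm_num)
        (by norm_num)
    -- With a common optimizer, `G'` cannot contain any constraint of `V G`, all of which that
    -- optimizer violates.
    refine hne (Finset.eq_of_subset_of_card_le (fun i hi => ?_) (by rw [hGT, hGT']))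
    rcases Finset.mem_union.1 (hG'V hi) with h | h
    · exact h
    · have := (Finset.mem_filter.1 ((hV G hGv).1 h)).2
      rw [hθeq] at this
      exact absurd (hθK G' hGT' i hi) this

end Geometry

/-! ### The suboptimality gap as a convex constraint. -/

section Gap

variable {S Act : Type*} {d : ℕ} {A : S → Set Act} {ψ : S → Act → EuclideanSpace ℝ (Fin d)}

theorem bddAbove_subGap (hA : ∀ θ s, (greedySet A ψ θ s).Nonempty)
    (θ : EuclideanSpace ℝ (Fin d)) (s : S) (a : Act) :
    BddAbove ((fun a' => inner ℝ θ (ψ s a' - ψ s a)) '' A s) := by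
  obtain ⟨b, -, hb⟩ := hA θ s
  refine ⟨inner ℝ θ (ψ s b - ψ s a), ?_⟩
  rintro _ ⟨a', ha', rfl⟩
  simp only [inner_sub_right]
  linarith [hb a' ha']

theorem le_subGap (hA : ∀ θ s, (greedySet A ψ θ s).Nonempty) (θ : EuclideanSpace ℝ (Fin d))
    (s : S) (a : Act) {a' : Act} (ha' : a' ∈ A s) :
    inner ℝ θ (ψ s a' - ψ s a) ≤ subGap A ψ θ s a :=
  le_csSup (bddAbove_subGap hA θ s a) ⟨a', ha', rfl⟩

theorem subGap_le (hA : ∀ θ s, (greedySet A ψ θ s).Nonempty) {θ : EuclideanSpace ℝ (Fin d)}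
    {s : S} {a : Act} {c : ℝ} (h : ∀ a' ∈ A s, inner ℝ θ (ψ s a' - ψ s a) ≤ c) :
    subGap A ψ θ s a ≤ c := by
  obtain ⟨b, hb, -⟩ := hA θ s
  refine csSup_le ⟨_, b, hb, rfl⟩ ?_
  rintro _ ⟨a', ha', rfl⟩
  exact h a' ha'

/-- A supremum of linear functions of `θ`. Convexity serves twice: for the constraint sets, and for
continuity in `θ`. -/
theorem convexOn_subGap (hA : ∀ θ s, (greedySet A ψ θ s).Nonempty) (s : S) (a : Act) :
    ConvexOn ℝ Set.univ fun θ => subGap A ψ θ s a := by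
  refine ⟨convex_univ, fun θ _ η _ x y hx hy _ => subGap_le hA fun a' ha' => ?_⟩
  rw [inner_add_left, real_inner_smul_left, real_inner_smul_left, smul_eq_mul, smul_eq_mul]
  exact add_le_add (mul_le_mul_of_nonneg_left (le_subGap hA θ s a ha') hx)
    (mul_le_mul_of_nonneg_left (le_subGap hA η s a ha') hy)

theorem notMem_greedySet_iff (hA : ∀ θ s, (greedySet A ψ θ s).Nonempty)
    (θ : EuclideanSpace ℝ (Fin d)) {s : S} {a : Act} (ha : a ∈ A s) :
    a ∉ greedySet A ψ θ s ↔ 0 < subGap A ψ θ s a := by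
  rw [← not_le, not_iff_not]
  constructor
  · rintro ⟨-, h⟩
    exact subGap_le hA fun a' ha' => by rw [inner_sub_right]; linarith [h a' ha']
  · refine fun h => ⟨ha, fun a' ha' => ?_⟩
    have := (le_subGap hA θ s a ha').trans h
    rw [inner_sub_right] at this
    linarith

end Gap

/-! ### Assembly of the scenario bound. -/

/-- The scenario bound: the optimizer of the scenario program has set-level mismatch at most `ε`
with probability at least one minus the binomial tail. -/
theorem one_sub_le_measureReal_setMismatch_le {S Act : Type*} [MeasurableSpace S] {d T : ℕ}
    (P : Measure S) [IsProbabilityMeasure P]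
    (A : S → Set Act) (ψ : S → Act → EuclideanSpace ℝ (Fin d))
    (hA : ∀ θ s, (greedySet A ψ θ s).Nonempty) (aStar : S → Act) (haStar : ∀ s, aStar s ∈ A s)
    (Θ : Set (EuclideanSpace ℝ (Fin d))) (hΘ : Convex ℝ Θ) (hΘm : MeasurableSet Θ)
    (hΘnorm : ∀ θ ∈ Θ, ∀ α : ℝ, α ≠ 1 → α • θ ∉ Θ)
    (hmeas : ∀ θ ∈ Θ, Measurable fun s => subGap A ψ θ s (aStar s))
    (J : EuclideanSpace ℝ (Fin d) → ℝ) (hJ : ConvexOn ℝ Set.univ J)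
    (θHat : (Fin T → S) → EuclideanSpace ℝ (Fin d))
    (hθHatm : AEMeasurable θHat (Measure.pi fun _ : Fin T => P))
    (hθHat : ∀ᵐ s ∂(Measure.pi fun _ : Fin T => P),
      IsUniqueOptimizer A ψ Θ J (demonstrations aStar s) (θHat s))
    {ε β : ℝ} (hε0 : 0 < ε) (hε1 : ε ≤ 1) (hβ1 : β < 1) (hβ : binomialTail d T ε ≤ β) :
    1 - β ≤ (Measure.pi fun _ : Fin T => P).real
      {s | setMismatch P A ψ aStar (θHat s) ≤ ε} := by
  classical
  set μ := Measure.pi fun _ : Fin T => P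
  obtain ⟨s₀, hs₀⟩ := hθHat.exists
  have hθ₀ : θHat s₀ ∈ Θ := hs₀.1.1.1
  have hdim := finrank_vectorSpan_lt hΘ ⟨_, hθ₀⟩ hΘnorm
  rw [finrank_euclideanSpace_fin] at hdim
  obtain ⟨k, rfl⟩ : ∃ k, d = k + 1 := ⟨d - 1, by omega⟩
  -- With fewer than `k` samples the tail equals `1`, which exceeds `β`.
  have hTk : k ≤ T := by
    by_contra! h
    rw [binomialTail_eq_one (by omega)] at hβ
    linarith
  -- A measurable version of the optimizer with all values in `Θ`, since measurability of the gap is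
  -- known only there; the default `θHat s₀` is used on a null set.
  have hf : ∀ s, (if hθHatm.mk θHat s ∈ Θ then hθHatm.mk θHat s else θHat s₀) ∈ Θ := fun s => by
    split_ifs with h
    exacts [h, hθ₀]
  let g : (Fin T → S) → Θ := fun s => ⟨_, hf s⟩
  have hg : Measurable g :=
    (Measurable.ite (hθHatm.measurable_mk hΘm) hθHatm.measurable_mk measurable_const).subtype_mk
  have hgeq : ∀ᵐ s ∂μ, (g s : EuclideanSpace ℝ (Fin (k + 1))) = θHat s := by
    filter_upwards [hθHatm.ae_eq_mk, hθHat] with s h1 h2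
    have : θHat s ∈ Θ := h2.1.1.1
    simp only [g]
    rw [← h1, if_pos this]
  let u : Θ → S → ℝ := fun θ z => subGap A ψ θ z (aStar z)
  -- Carathéodory: continuous in `θ`, as a finite convex function on a finite-dimensional space, and
  -- measurable in the state.
  have hu : Measurable (Function.uncurry u) := by
    refine measurable_uncurry_of_continuous_of_measurable (fun z => ?_) fun θ => hmeas θ θ.2
    exact (continuousOn_univ.1 ((convexOn_subGap hA z (aStar z)).continuousOn
      isOpen_univ)).comp continuous_subtype_val
  let Vi : Set (Θ × S) := {x | 0 < Function.uncurry u x}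
  have hVi : MeasurableSet Vi := measurableSet_lt measurable_const hu
  have hmis : ∀ θ : Θ, P.real {z | (θ, z) ∈ Vi} = setMismatch P A ψ aStar θ := fun θ => by
    rw [setMismatch]
    congr 1
    ext z
    exact (notMem_greedySet_iff hA θ (haStar z)).symm
  have hbound := measureReal_lt_le_binomialTail P (k := k) hg hVi hε0 hε1 (fun M v hv => by
    have hQ : ∀ᵐ s ∂μ, IsUniqueOptimizer A ψ Θ J (demonstrations aStar s) (g s) := by
      filter_upwards [hθHat, hgeq] with s h1 h2
      rwa [h2]
    filter_upwards [ae_comp_orderEmbOfFin (n := T + M) P hQ] with ω hω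
    let K : Fin (T + M) → Set (EuclideanSpace ℝ (Fin (k + 1))) :=
      fun i => {x | subGap A ψ x (ω i) (aStar (ω i)) ≤ 0}
    have hK : ∀ i, Convex ℝ (K i) := fun i => by
      simpa using (convexOn_subGap hA (ω i) (aStar (ω i))).convex_le 0
    let θ : Finset (Fin (T + M)) → EuclideanSpace ℝ (Fin (k + 1)) := fun G =>
      if hG : G.card = T then g fun j => ω (G.orderEmbOfFin hG j) else 0
    have hθ : ∀ (G : Finset (Fin (T + M))) (hG : G.card = T), θ G = g fun j => ω (G.orderEmbOfFin hG j) :=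
      fun G hG => dif_pos hG
    have hfeas : ∀ (G : Finset (Fin (T + M))) (hG : G.card = T) x, x ∈ scenarioFeasible A ψ Θ
        (demonstrations aStar fun j => ω (G.orderEmbOfFin hG j)) ↔
          x ∈ Θ ∧ ∀ i ∈ G, x ∈ K i := fun G hG x => by
      refine and_congr_right fun _ => ⟨fun h i hi => ?_, fun h t => ?_⟩
      · have : i ∈ Set.range (G.orderEmbOfFin hG) := by rwa [Finset.range_orderEmbOfFin]
        obtain ⟨t, rfl⟩ := this
        exact h t
      · exact h _ (Finset.orderEmbOfFin_mem G hG t)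
    have hopt : ∀ (G : Finset (Fin (T + M))) (hG : G.card = T), IsUniqueOptimizer A ψ Θ J
        (demonstrations aStar fun j => ω (G.orderEmbOfFin hG j)) (θ G) := fun G hG => by
      rw [hθ G hG]
      exact hω G hG
    simp only [IsUniqueOptimizer, isMinOn_iff, hfeas] at hopt
    have := card_mul_factorial_le_of_optimizer (v := v) (k := k) hΘ (by omega) hJ K hK
      (by omega) hTk θ (fun G hG => (hopt G hG).1.1.1) (fun G hG => (hopt G hG).1.1.2)
      (fun G hG x hx hxK => (hopt G hG).1.2 x ⟨hx, hxK⟩)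
      (fun G hG x hx hxK hle => (hopt G hG).2 x ⟨hx, hxK⟩
        fun y hy => hle.trans ((hopt G hG).1.2 y hy))
    refine le_trans (le_of_eq ?_) this
    congr 3
    ext G
    simp only [Finset.mem_filter]
    refine and_congr_right fun hG => ?_
    have hGT := (Finset.mem_powersetCard.1 hG).2
    have hcount : violCount g Vi G hGT ω = (Gᶜ.filter fun i => θ G ∉ K i).card := by
      simp only [violCount, hθ G hGT]
      congr 1
      ext i
      rw [Finset.mem_filter, Finset.mem_filter]
      refine and_congr_right fun _ => ?_
      change 0 < subGap A ψ _ (ω i) (aStar (ω i)) ↔ ¬ subGap A ψ _ (ω i) (aStar (ω i)) ≤ 0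
      exact not_le.symm
    rw [← hcount]
    exact ⟨fun ⟨_, h⟩ => h, fun h => ⟨hGT, h⟩⟩)
  have hset : MeasurableSet {s | ε < P.real {z | (g s, z) ∈ Vi}} := by
    refine measurableSet_lt measurable_const ?_
    exact (measurable_measure_prodMk_left
      (((hg.comp measurable_fst).prodMk measurable_snd) hVi)).ennreal_toReal
  have hcongr : μ.real {s | setMismatch P A ψ aStar (θHat s) ≤ ε}
      = μ.real {s | ε < P.real {z | (g s, z) ∈ Vi}}ᶜ := by
    refine measureReal_congr ?_
    filter_upwards [hgeq] with s hs
    refine propext ?_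
    change setMismatch P A ψ aStar (θHat s) ≤ ε ↔ ¬ ε < P.real {z | (g s, z) ∈ Vi}
    rw [hmis, hs, not_lt]
  rw [hcongr, probReal_compl_eq_one_sub hset]
  linarith

end InverseOpt

theorem mainTheorem1 {S Act : Type*} [MeasurableSpace S] {d T : ℕ}
    (P : Measure S) [IsProbabilityMeasure P]
    (A : S → Set Act) (ψ : S → Act → EuclideanSpace ℝ (Fin d))
    (hA : ∀ θ s, (InverseOpt.greedySet A ψ θ s).Nonempty)
    (θStar : EuclideanSpace ℝ (Fin d)) (aStar : S → Act)
    (haStar : ∀ s, aStar s ∈ InverseOpt.greedySet A ψ θStar s)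
    (Θ : Set (EuclideanSpace ℝ (Fin d))) (hΘ : Convex ℝ Θ) (hΘm : MeasurableSet Θ)
    (hΘnorm : ∀ θ ∈ Θ, ∀ α : ℝ, α ≠ 1 → α • θ ∉ Θ)
    (hmeas : ∀ θ ∈ Θ, Measurable fun s => InverseOpt.subGap A ψ θ s (aStar s))
    (J : EuclideanSpace ℝ (Fin d) → ℝ) (hJ : ConvexOn ℝ Set.univ J)
    (θHat : (Fin T → S) → EuclideanSpace ℝ (Fin d))
    (hθHatm : AEMeasurable θHat (Measure.pi fun _ : Fin T => P))
    (hθHat : ∀ᵐ s ∂(Measure.pi fun _ : Fin T => P),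
      InverseOpt.IsUniqueOptimizer A ψ Θ J (InverseOpt.demonstrations aStar s) (θHat s))
    (β : ℝ) (hβ0 : 0 < β) (hβ1 : β < 1) :
    (∀ ε : ℝ, 0 < ε → ε ≤ 1 → InverseOpt.sampleSize d ε β ≤ T →
      1 - β ≤ (Measure.pi fun _ : Fin T => P).real
        {s | InverseOpt.setMismatch P A ψ aStar (θHat s) ≤ ε}) ∧
    (2 * (d + Real.log (1 / β)) ≤ (T : ℝ) →
      InverseOpt.sampleSize d (2 / T * (d + Real.log (1 / β))) β ≤ T ∧
      1 - β ≤ (Measure.pi fun _ : Fin T => P).real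
        {s | InverseOpt.setMismatch P A ψ aStar (θHat s)
          ≤ 2 / T * (d + Real.log (1 / β))}) := by
  have hA' : ∀ s, aStar s ∈ A s := fun s => (haStar s).1
  have hlog : 0 < Real.log (1 / β) := Real.log_pos ((one_lt_div hβ0).2 hβ1)
  refine ⟨fun ε hε0 hε1 hN => ?_, fun hT => ?_⟩
  · exact InverseOpt.one_sub_le_measureReal_setMismatch_le P A ψ hA aStar hA' Θ hΘ hΘm hΘnorm hmeas J hJ θHat hθHatm
      hθHat hε0 hε1 hβ1 (InverseOpt.binomialTail_le_of_sampleSize_le hε0 hε1 hβ0 hN)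
  · have hd : (0 : ℝ) < d + Real.log (1 / β) := by positivity
    have hT0 : (0 : ℝ) < T := by linarith
    have hε0 : 0 < 2 / T * (d + Real.log (1 / β)) := by positivity
    have hε1 : 2 / T * (d + Real.log (1 / β)) ≤ 1 := by
      rw [div_mul_eq_mul_div, div_le_one hT0]
      exact hT
    have htail : InverseOpt.binomialTail d T (2 / T * (d + Real.log (1 / β))) ≤ β :=
      InverseOpt.binomialTail_le_of_eq hε0.le hε1 hβ0 (by field_simp)
    exact ⟨Nat.sInf_le htail, InverseOpt.one_sub_le_measureReal_setMismatch_le P A ψ hA aStar hA' Θ hΘ hΘm hΘnorm hmeas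
      J hJ θHat hθHatm hθHat hε0 hε1 hβ1 htail⟩
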